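/- Let $\Omega=(0,1)$, $\phi_k(x)=\sqrt2\sin(k\pi x)$, $\lambda_k=k^2\pi^2$ ($k\ge 1$), let $(\cdot,\cdot)$ be the $L^2(\Omega)$ inner product, and for $\sigma\ge 0$ let $\hat H^\sigma(\Omega)=\{v\in L^2(\Omega):\|v\|_{\hat H^\sigma}<\infty\}$ with $\|v\|_{\hat H^\sigma}^2=\sum_{k\ge1}\lambda_k^\sigma(v,\phi_k)^2$. For $\alpha\in(0,1)$ let ${}_0\partial_t^\alpha w(t)=\frac1{\Gamma(1-\alpha)}\frac{d}{dt}\int_0^t(t-\xi)^{-\alpha}w(\xi)\,d\xi$ be the Riemann--Liouville derivative. For $f:[0,T]\to L^2(\Omega)$ let $u$ be a solution of $$ {}_0\partial_t^\alpha(u-u_0)-\Delta u=f \ \text{ in } \Omega\times(0,T],\qquad u=0\ \text{ on }\partial\Omega\times(0,T],\qquad u(0)=u_0,$$ that is, $u\in C([0,T];L^2(\Omega))$, $u(t)\in H^2(\Omega)\cap H^1_0(\Omega)$ for $t\in(0,T]$ (identified with its continuous representative), and the equation holds in $L^2(\Omega)$ for all $t\in(0,T]$. Let $N\ge1$ be an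 integer, $h=1/N$, $x_i=i/N$, and $P_Nv=\sum_{k=1}^{N-1}(v,\phi_k)\phi_k$. Let $\mathbf u_{h,p}=(u_{h,p,1},\dots,u_{h,p,N-1})$, continuous on $[0,T]$, solve the modified central difference scheme $$ {}_0\partial_t^\alpha\bigl(u_{h,p,i}-(P_Nu_0)(x_i)\bigr)+N^2\sum_{j=1}^{N-1}w_{i,j}u_{h,p,j}=(P_Nf)(x_i),\quad t\in(0,T],\qquad u_{h,p,i}(0)=(P_Nu_0)(x_i),$$ for $i=1,\dots,N-1$, where $w_{i,i}=2$, $w_{i,j}=-1$ if $|i-j|=1$, and $w_{i,j}=0$ otherwise. Write $\mathbf u(t)=(u(x_1,t),\dots,u(x_{N-1},t))$, and for $\mathbf v\in\mathbb R^M$ put $\|\mathbf v\|_{l^2}^2=\frac1M\sum_{k=1}^M v_k^2$ and $\|\mathbf v\|_{l^\infty}=\max_{1\le k\le M}|v_k|$ (both are $0$ if $M=0$). Let $\ell_h=|\ln h|^{1/2}$, and let $\chi_0(x)=1$ if $x=0$ and $\chi_0(x)=0$ otherwise. **Theorem.** Let $\alpha\in(0,1)$ and $\sigma\ge0$. There is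 a constant $C>0$, depending only on $\alpha$ and $\sigma$, such that the following holds for all $T>0$, all $N\ge 1$, all $f$, $u$, $\mathbf u_{h,p}$ as above with $u_0=0$, and all $t\in(0,T]$. If $f$ is absolutely continuous from $[0,t]$ to $L^2(\Omega)$ with integrable time derivative $f_t$ (that is, $f(s)=f(0)+\int_0^s f_t(r)\,dr$ for $s\in[0,t]$), $f(0)\in\hat H^\sigma(\Omega)$ and $\int_0^t\|f_t(s)\|_{\hat H^\sigma}\,ds<\infty$, then $$\|\mathbf u(t)-\mathbf u_{h,p}(t)\|_{l^\infty}\le C\,h^{\min(\sigma+\frac32,2)}\,\ell_h^{\chi_0(\frac14-\frac\sigma2)}\Bigl(\|f(0)\|_{\hat H^\sigma}+\int_0^t\|f_t(s)\|_{\hat H^\sigma}\,ds\Bigr)$$ and $$\|\mathbf u(t)-\mathbf u_{h,p}(t)\|_{l^2}\le C\,h^{2}\Bigl(\|f(0)\|_{\hat H^\sigma}+\int_0^t\|f_t(s)\|_{\hat H^\sigma}\,ds\Bigr).$$ -/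

import Mathlib

open MeasureTheory Set
open scoped ENNReal

noncomputable section

namespace SubDiffusion

/-! ## The spatial domain `Ω = (0,1)`, the Dirichlet eigenpairs and the spaces `Ĥ^σ(Ω)` -/

/-- The spatial domain `Ω = (0,1)`. -/
abbrev Omega : Set ℝ := Ioo 0 1

/-- The Hilbert space `L²(Ω)`. -/
abbrev L2 : Type := Lp ℝ 2 (volume.restrict Omega)

/-- The Dirichlet eigenfunction `φ_k(x) = √2 sin(kπx)`. -/
def phi (k : ℕ) (x : ℝ) : ℝ := √2 * Real.sin (k * Real.pi * x)

/-- The Dirichlet eigenvalue `λ_k = k²π²`. -/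
def lam (k : ℕ) : ℝ := (k : ℝ) ^ 2 * Real.pi ^ 2

/-- The `L²(Ω)` inner product `(v, φ_k)`. -/
def coef (v : L2) (k : ℕ) : ℝ := ∫ x in Omega, v x * phi k x

/-- The norm of `Ĥ^σ(Ω)`, `‖v‖² = ∑_{k ≥ 1} λ_k^σ (v, φ_k)²`, with the value `∞` allowed.
The space `Ĥ^σ(Ω)` consists of the `v` in `L²(Ω)` with `hatNorm σ v < ∞`. -/
def hatNorm (σ : ℝ) (v : L2) : ℝ≥0∞ :=
  (∑' k : ℕ+, ENNReal.ofReal (lam k ^ σ * coef v k ^ 2)) ^ (1 / 2 : ℝ)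

/-- The function `P_N v = ∑_{k=1}^{N-1} (v, φ_k) φ_k`, the `L²`-orthogonal projection of `v`
onto the span of `φ_1, …, φ_{N-1}`. -/
def projN (N : ℕ) (v : L2) (x : ℝ) : ℝ :=
  ∑ k ∈ Finset.Icc 1 (N - 1), coef v k * phi k x

/-- `v ∈ H²(Ω) ∩ H¹₀(Ω)` (through its continuous representative on `[0,1]`), and `-Δ v = g`:
`v` and its derivative `v'` are absolutely continuous on `[0,1]`, `v'' = -g` almost everywhere,
and `v` vanishes at both end points. -/
def IsDirichletLaplacian (v : ℝ → ℝ) (g : L2) : Prop :=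
  v 0 = 0 ∧ v 1 = 0 ∧
    ∃ v' : ℝ → ℝ,
      (∀ x ∈ Icc (0 : ℝ) 1, v x = v 0 + ∫ y in (0 : ℝ)..x, v' y) ∧
      (∀ x ∈ Icc (0 : ℝ) 1, v' x = v' 0 - ∫ y in (0 : ℝ)..x, g y)

/-! ## The Riemann--Liouville derivative and the continuous problem -/

/-- The fractional integral of order `1 - α`,
`Γ(1-α)⁻¹ ∫_0^t (t-ξ)^{-α} w(ξ) dξ`, of a function with values in a Banach space. -/
def rlIntegral {E : Type*} [NormedAddCommGroup E] [NormedSpace ℝ E]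
    (α : ℝ) (w : ℝ → E) (t : ℝ) : E :=
  (1 / Real.Gamma (1 - α)) • ∫ ξ in (0 : ℝ)..t, (t - ξ) ^ (-α) • w ξ

/-- The Riemann--Liouville derivative of order `α` of `w : [0,T] → E` exists at `t` and equals
`d`. (At `t = T` the outer derivative is the one from the left.) -/
def HasRLDerivAt {E : Type*} [NormedAddCommGroup E] [NormedSpace ℝ E]
    (α T : ℝ) (w : ℝ → E) (d : E) (t : ℝ) : Prop :=
  HasDerivWithinAt (rlIntegral α w) d (Icc 0 T) t

/-- `u` (with `u t x` the value at time `t` and at the point `x`) is a solution of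
`∂_t^α (u - u₀) + A u = f` on `Ω × (0,T]`, `u = 0` on `∂Ω × (0,T]`, `u(0) = u₀`, where
`A = -Δ` with homogeneous Dirichlet boundary condition: `t ↦ u(t)` is continuous from `[0,T]`
to `L²(Ω)`, `u(t)` lies in `H²(Ω) ∩ H¹₀(Ω)` for `t ∈ (0,T]`, and the equation holds in `L²(Ω)`
for every `t ∈ (0,T]`. -/
def IsSolution (α T : ℝ) (u₀ : L2) (f : ℝ → L2) (u : ℝ → ℝ → ℝ) : Prop :=
  ∃ U : ℝ → L2,
    (∀ t ∈ Icc 0 T, (U t : ℝ → ℝ) =ᵐ[volume.restrict Omega] u t) ∧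
    ContinuousOn U (Icc 0 T) ∧
    U 0 = u₀ ∧
    ∀ t ∈ Ioc 0 T, ∃ g : L2, IsDirichletLaplacian (u t) g ∧
      HasRLDerivAt α T (fun s => U s - u₀) (f t - g) t

/-- `ft` is the time derivative of the (absolutely continuous) function `f : [0,t] → L²(Ω)`:
`ft` is integrable on `(0,t)` and `f(s) = f(0) + ∫_0^s ft(r) dr` for `s ∈ [0,t]`. -/
def IsTimeDerivOn (t : ℝ) (f ft : ℝ → L2) : Prop :=
  IntegrableOn ft (Ioc 0 t) ∧ ∀ s ∈ Icc 0 t, f s = f 0 + ∫ r in (0 : ℝ)..s, ft r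

/-! ## The modified central difference scheme -/

/-- The interior mesh point `x_i = i h`, `h = 1/N`, `i = 1, …, N-1`; the index `i` of the mesh
point is shifted by one, since `Fin (N - 1)` starts at `0`. -/
def node (N : ℕ) (i : Fin (N - 1)) : ℝ := ((i : ℕ) + 1 : ℝ) / N

/-- The vector `I_N v` of the values of a function `v` at the interior mesh points. -/
def sample (N : ℕ) (v : ℝ → ℝ) : Fin (N - 1) → ℝ := fun i => v (node N i)

/-- The entries of `tridiag(-1, 2, -1)`. -/
def diffWeight {M : ℕ} (i j : Fin M) : ℝ :=
  if i = j then 2 else if (i : ℕ) + 1 = j ∨ (j : ℕ) + 1 = i then -1 else 0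

/-- `uh : [0,T] → ℝ^{N-1}` solves the modified scheme
`∂_t^α (uh_i - (P_N u₀)(x_i)) + N² ∑_j w_{ij} uh_j = (P_N f)(x_i)` on `(0,T]`,
with `uh_i(0) = (P_N u₀)(x_i)`, `i = 1, …, N-1`. -/
def IsModifiedSchemeSolution (α T : ℝ) (N : ℕ) (u₀ : L2) (f : ℝ → L2)
    (uh : ℝ → Fin (N - 1) → ℝ) : Prop :=
  ∀ i : Fin (N - 1),
    ContinuousOn (fun t => uh t i) (Icc 0 T) ∧
    uh 0 i = sample N (projN N u₀) i ∧
    ∀ t ∈ Ioc 0 T,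
      HasRLDerivAt α T (fun s => uh s i - sample N (projN N u₀) i)
        (sample N (projN N (f t)) i - (N : ℝ) ^ 2 * ∑ j, diffWeight i j * uh t j) t

/-- The discrete norm `‖v‖_{l²} = (M⁻¹ ∑_{k=1}^M v_k²)^{1/2}`. -/
def l2Norm {M : ℕ} (v : Fin M → ℝ) : ℝ := √(1 / (M : ℝ) * ∑ k, v k ^ 2)

/-- The discrete norm `‖v‖_{l^∞} = max_{1 ≤ k ≤ M} |v_k|` (zero for `M = 0`). -/
def linfNorm {M : ℕ} (v : Fin M → ℝ) : ℝ := ⨆ k, |v k|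

/-- `ℓ_h = |ln h|^{1/2}`. -/
def ell (h : ℝ) : ℝ := |Real.log h| ^ (1 / 2 : ℝ)

/-- The characteristic function of the point `0`. -/
def chi0 (x : ℝ) : ℝ := if x = 0 then 1 else 0

end SubDiffusion

end

open SubDiffusion

namespace SubDiffusion

section

open Filter Topology

/-! ## A maximum principle for the Riemann--Liouville derivative -/

lemma intervalIntegrable_sub_rpow {α : ℝ} (hα1 : α < 1) (s a b : ℝ) :
    IntervalIntegrable (fun ξ : ℝ => (s - ξ) ^ (-α)) volume a b := by
  have h := (intervalIntegral.intervalIntegrable_rpow' (a := s - a) (b := s - b)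
    (r := -α) (by linarith)).comp_sub_left (c := s)
  simpa using h

/-- The Caputo derivative of a `C¹` function is nonnegative at a maximum point. -/
lemma caputo_nonneg_of_isMax {α s : ℝ} (hα0 : 0 < α) (hα1 : α < 1) (hs : 0 < s) {y y' : ℝ → ℝ}
    (hy : ∀ x, HasDerivAt y (y' x) x) (hy' : Continuous y')
    (hmax : ∀ ξ ∈ Icc 0 s, y ξ ≤ y s) :
    0 ≤ ∫ ξ in (0 : ℝ)..s, (s - ξ) ^ (-α) * y' ξ := by
  have hyc : Continuous y := continuous_iff_continuousAt.2 fun x => (hy x).continuousAt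
  have hint : IntervalIntegrable (fun ξ : ℝ => (s - ξ) ^ (-α) * y' ξ) volume 0 s :=
    (intervalIntegrable_sub_rpow hα1 s 0 s).mul_continuousOn hy'.continuousOn
  have hL : Tendsto (fun b => ∫ ξ in (0 : ℝ)..b, (s - ξ) ^ (-α) * y' ξ) (𝓝[<] s)
      (𝓝 (∫ ξ in (0 : ℝ)..s, (s - ξ) ^ (-α) * y' ξ)) := by
    have h := intervalIntegral.continuousOn_primitive_interval' hint left_mem_uIcc
    have h2 := h s right_mem_uIcc
    rw [uIcc_of_le hs.le] at h2
    refine h2.mono_left ?_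
    rw [← nhdsWithin_Ioo_eq_nhdsLT hs]
    exact nhdsWithin_mono _ Ioo_subset_Icc_self
  have hR : Tendsto (fun b => -((s - b) ^ (1 - α) * slope y s b)) (𝓝[<] s) (𝓝 0) := by
    have h1 : Tendsto (slope y s) (𝓝[<] s) (𝓝 (y' s)) :=
      (hasDerivAt_iff_tendsto_slope.1 (hy s)).mono_left (nhdsWithin_mono _ fun x hx => ne_of_lt hx)
    have h2 : Tendsto (fun b : ℝ => (s - b) ^ (1 - α)) (𝓝[<] s) (𝓝 0) := by
      have : Continuous fun b : ℝ => (s - b) ^ (1 - α) :=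
        (continuous_const.sub continuous_id).rpow_const fun x => Or.inr (by linarith)
      have h3 := this.tendsto s
      rw [sub_self, Real.zero_rpow (by linarith)] at h3
      exact h3.mono_left nhdsWithin_le_nhds
    simpa using (h2.mul h1).neg
  refine le_of_tendsto_of_tendsto hR hL ?_
  rw [← nhdsWithin_Ioo_eq_nhdsLT hs]
  filter_upwards [self_mem_nhdsWithin] with b hb
  have hsb : 0 < s - b := by linarith [hb.2]
  have hder : ∀ ξ ∈ uIcc 0 b, HasDerivAt (fun ξ : ℝ => (s - ξ) ^ (-α))
      (α * (s - ξ) ^ (-α - 1)) ξ := by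
    intro ξ hξ
    rw [uIcc_of_le hb.1.le] at hξ
    have h := ((hasDerivAt_id' ξ).const_sub s).rpow_const (p := -α)
      (Or.inl (by linarith [hξ.2]))
    convert h using 1
    ring
  have hparts := intervalIntegral.integral_mul_deriv_eq_deriv_mul hder
    (fun ξ _ => (hy ξ).sub_const (y s)) (ContinuousOn.intervalIntegrable (by
      intro ξ hξ
      rw [uIcc_of_le hb.1.le] at hξ
      refine (ContinuousAt.mul continuousAt_const (ContinuousAt.rpow_const
        (continuousAt_const.sub continuousAt_id) (Or.inl (ne_of_gt ?_)))).continuousWithinAt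
      simp only [Pi.sub_apply, id]; linarith [hξ.2])) (hy'.intervalIntegrable _ _)
  rw [hparts]
  have h1 : (s - b) ^ (-α) * (y b - y s) = -((s - b) ^ (1 - α) * slope y s b) := by
    rw [slope_def_field, show (1 - α) = -α + 1 by ring, Real.rpow_add_one hsb.ne']
    have : b - s ≠ 0 := by linarith
    field_simp
    ring
  have h2 : (s - 0) ^ (-α) * (y 0 - y s) ≤ 0 :=
    mul_nonpos_of_nonneg_of_nonpos (Real.rpow_nonneg (by linarith) _)
      (by linarith [hmax 0 ⟨le_rfl, hs.le⟩])
  have h3 : ∫ ξ in (0 : ℝ)..b, α * (s - ξ) ^ (-α - 1) * (y ξ - y s) ≤ 0 := by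
    rw [← neg_nonneg, ← intervalIntegral.integral_neg]
    refine intervalIntegral.integral_nonneg hb.1.le fun ξ hξ => ?_
    rw [← mul_neg]
    refine mul_nonneg (mul_nonneg hα0.le (Real.rpow_nonneg (by linarith [hξ.2]) _)) ?_
    linarith [hmax ξ ⟨hξ.1, by linarith [hξ.2]⟩]
  linarith

lemma rlIntegral_eq_sub {α s r : ℝ} (hα1 : α < 1) (hr : 0 ≤ r) (hrs : r ≤ s)
    {v p : ℝ → ℝ} (hv : ContinuousOn v (Icc 0 s)) (hp : ContinuousOn p (Icc 0 s))
    (hD : ∀ x ∈ Ioc 0 s, HasRLDerivAt α s v (p x) x) :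
    rlIntegral α v s - rlIntegral α v r = ∫ x in r..s, p x := by
  have hs : 0 ≤ s := hr.trans hrs
  have hcont : ContinuousOn (rlIntegral α v) (Icc 0 s) := by
    intro x hx
    rcases hx.1.eq_or_lt with rfl | hx0
    · obtain ⟨M, hM⟩ := isCompact_Icc.exists_bound_of_continuousOn hv
      have hM0 : 0 ≤ M := (norm_nonneg _).trans (hM 0 hx)
      have hb : ∀ t ∈ Icc 0 s, ‖rlIntegral α v t‖ ≤
          |1 / Real.Gamma (1 - α)| * (M * (t ^ (1 - α) / (1 - α))) := by
        intro t ht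
        rw [rlIntegral, norm_smul, Real.norm_eq_abs]
        refine mul_le_mul_of_nonneg_left ?_ (abs_nonneg _)
        have h1 : ‖∫ ξ in (0 : ℝ)..t, (t - ξ) ^ (-α) • v ξ‖ ≤
            ∫ ξ in (0 : ℝ)..t, M * (t - ξ) ^ (-α) := by
          refine intervalIntegral.norm_integral_le_of_norm_le ht.1 ?_
            ((intervalIntegrable_sub_rpow hα1 t 0 t).const_mul M)
          refine Eventually.of_forall fun ξ hξ => ?_
          rw [norm_smul, Real.norm_eq_abs, abs_of_nonneg (Real.rpow_nonneg (by linarith [hξ.2]) _),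
            mul_comm]
          exact mul_le_mul_of_nonneg_right (hM ξ ⟨hξ.1.le, hξ.2.trans ht.2⟩)
            (Real.rpow_nonneg (by linarith [hξ.2]) _)
        refine h1.trans_eq ?_
        rw [intervalIntegral.integral_const_mul,
          intervalIntegral.integral_comp_sub_left (fun z : ℝ => z ^ (-α)) t,
          integral_rpow (Or.inl (by linarith))]
        rw [sub_self, sub_zero, Real.zero_rpow (by linarith), sub_zero,
          show -α + 1 = 1 - α by ring]
      have h0 : rlIntegral α v 0 = 0 := by simp [rlIntegral]
      rw [ContinuousWithinAt, h0]
      refine squeeze_zero_norm' (eventually_nhdsWithin_of_forall hb) ?_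
      have hc : Continuous fun t : ℝ => |1 / Real.Gamma (1 - α)| * (M * (t ^ (1 - α) / (1 - α))) :=
        continuous_const.mul (continuous_const.mul
          ((continuous_id.rpow_const fun x => Or.inr (by linarith)).div_const _))
      have h3 := hc.tendsto 0
      rw [Real.zero_rpow (by linarith)] at h3
      simpa using h3.mono_left nhdsWithin_le_nhds
    · exact (hD x ⟨hx0, hx.2⟩).continuousWithinAt
  symm
  refine intervalIntegral.integral_eq_sub_of_hasDerivAt_of_le hrs
    (hcont.mono (Icc_subset_Icc hr le_rfl)) (fun x hx => ?_)
    ((hp.mono (by rw [uIcc_of_le hrs]; exact Icc_subset_Icc hr le_rfl)).intervalIntegrable)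
  exact (hD x ⟨hr.trans_lt hx.1, hx.2.le⟩).hasDerivAt
    (Icc_mem_nhds (hr.trans_lt hx.1) hx.2)

lemma HasRLDerivAt.mono {E : Type*} [NormedAddCommGroup E] [NormedSpace ℝ E] {α T T' t : ℝ}
    {w : ℝ → E} {d : E} (h : HasRLDerivAt α T w d t) (hT : T' ≤ T) : HasRLDerivAt α T' w d t :=
  HasDerivWithinAt.mono h (Icc_subset_Icc le_rfl hT)

/-- Upper half of the maximum principle, for the backward means of `v` over a window of
length `h`. -/
lemma mean_le_of_hasRLDerivAt {α t lam G h : ℝ} (hα0 : 0 < α) (hα1 : α < 1) (ht : 0 < t)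
    (hlam : 0 < lam) (hG0 : 0 ≤ G) (hh : 0 < h) {v g : ℝ → ℝ} (hv : Continuous v)
    (hv0 : ∀ x ≤ 0, v x = 0) (hg : ContinuousOn g (Icc 0 t))
    (hD : ∀ s ∈ Ioc 0 t, HasRLDerivAt α t v (g s - lam * v s) s)
    (hG : ∀ s ∈ Icc 0 t, g s ≤ G) :
    h⁻¹ * ∫ x in (t - h)..t, v x ≤ G / lam := by
  set V : ℝ → ℝ := fun s => ∫ x in (0 : ℝ)..s, v x with hV
  have hVd : ∀ x, HasDerivAt V (v x) x := fun x => hv.integral_hasStrictDerivAt 0 x |>.hasDerivAt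
  set y : ℝ → ℝ := fun s => h⁻¹ * (V s - V (s - h)) with hydef
  have hyint : ∀ s, y s = h⁻¹ * ∫ x in (s - h)..s, v x := by
    intro s
    simp only [hydef, hV]
    rw [intervalIntegral.integral_interval_sub_left (hv.intervalIntegrable _ _)
      (hv.intervalIntegrable _ _)]
  have hyd : ∀ x, HasDerivAt y (h⁻¹ * (v x - v (x - h))) x := by
    intro x
    have h1 := (hVd (x - h)).comp_sub_const x h
    exact ((hVd x).sub h1).const_mul _
  have hyc : Continuous y := continuous_iff_continuousAt.2 fun x => (hyd x).continuousAt
  rw [← hyint]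
  obtain ⟨s, hs, hsmax⟩ := isCompact_Icc.exists_isMaxOn (nonempty_Icc.2 ht.le) hyc.continuousOn
  have hyt : y t ≤ y s := hsmax (right_mem_Icc.2 ht.le)
  refine hyt.trans ?_
  rcases hs.1.eq_or_lt with hs0 | hs0
  · have : y s = 0 := by
      rw [hyint, ← hs0]
      have : ∫ x in (0 - h)..0, v x = ∫ x in (0 - h)..0, (0 : ℝ) := by
        refine intervalIntegral.integral_congr fun x hx => ?_
        rw [uIcc_of_le (by linarith)] at hx
        exact hv0 x hx.2
      rw [this]; simp
    rw [this]; positivity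
  have hcap := caputo_nonneg_of_isMax hα0 hα1 hs0 hyd (by fun_prop)
    (fun ξ hξ => hsmax ⟨hξ.1, hξ.2.trans hs.2⟩)
  have hsub : Icc 0 s ⊆ Icc 0 t := Icc_subset_Icc le_rfl hs.2
  have hΓ : 0 < Real.Gamma (1 - α) := Real.Gamma_pos_of_pos (by linarith)
  set r : ℝ := max (s - h) 0 with hr
  have hr0 : 0 ≤ r := le_max_right _ _
  have hrs : r ≤ s := max_le (by linarith) hs0.le
  have hrh : s - r ≤ h := by linarith [le_max_left (s - h) 0]
  have hkey : rlIntegral α v s - rlIntegral α v r =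
      (1 / Real.Gamma (1 - α)) * (h * ∫ ξ in (0 : ℝ)..s, (s - ξ) ^ (-α) *
        (h⁻¹ * (v ξ - v (ξ - h)))) := by
    have hI := intervalIntegrable_sub_rpow hα1 s
    have h1 : ∫ ξ in (0 : ℝ)..s, (s - ξ) ^ (-α) * (h⁻¹ * (v ξ - v (ξ - h))) =
        h⁻¹ * ((∫ ξ in (0 : ℝ)..s, (s - ξ) ^ (-α) * v ξ) -
          ∫ ξ in (0 : ℝ)..s, (s - ξ) ^ (-α) * v (ξ - h)) := by
      rw [← intervalIntegral.integral_sub ((hI 0 s).mul_continuousOn hv.continuousOn)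
        ((hI 0 s).mul_continuousOn (by fun_prop)), ← intervalIntegral.integral_const_mul]
      congr 1; ext ξ; ring
    have h2 : ∫ ξ in (0 : ℝ)..s, (s - ξ) ^ (-α) * v (ξ - h) =
        ∫ ξ in (0 : ℝ)..r, (r - ξ) ^ (-α) * v ξ := by
      have h3 := intervalIntegral.integral_comp_sub_right (a := 0) (b := s)
        (fun η => (s - h - η) ^ (-α) * v η) h
      have h4 : ∫ ξ in (0 : ℝ)..s, (s - ξ) ^ (-α) * v (ξ - h) =
          ∫ η in (0 - h)..(s - h), (s - h - η) ^ (-α) * v η := by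
        rw [← h3]; congr 1; ext ξ; ring_nf
      rw [h4]
      have hz : ∀ a b : ℝ, a ≤ 0 → b ≤ 0 → ∀ c : ℝ,
          ∫ η in a..b, (c - η) ^ (-α) * v η = 0 := by
        intro a b ha hb c
        have : ∫ η in a..b, (c - η) ^ (-α) * v η = ∫ η in a..b, (0 : ℝ) := by
          refine intervalIntegral.integral_congr fun x hx => ?_
          have hx0 : x ≤ 0 := hx.2.trans (max_le ha hb)
          simp [hv0 x hx0]
        rw [this]; simp
      rcases le_total (s - h) 0 with hc | hc
      · have : r = 0 := max_eq_right hc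
        rw [hz _ _ (by linarith) hc, this]; simp
      · have : r = s - h := max_eq_left hc
        have hI' := intervalIntegrable_sub_rpow hα1 (s - h)
        rw [← intervalIntegral.integral_add_adjacent_intervals
          ((hI' (0 - h) 0).mul_continuousOn hv.continuousOn)
          ((hI' 0 (s - h)).mul_continuousOn hv.continuousOn),
          hz (0 - h) 0 (by linarith) le_rfl, zero_add, this]
    rw [h1, h2]
    simp only [rlIntegral, smul_eq_mul]
    field_simp
  have hflux := rlIntegral_eq_sub (p := fun x => g x - lam * v x) hα1 hr0 hrs hv.continuousOn
    ((hg.mono hsub).sub (continuous_const.mul hv).continuousOn)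
    (fun x hx => (hD x ⟨hx.1, hx.2.trans hs.2⟩).mono hs.2)
  have hpos : 0 ≤ ∫ x in r..s, (g x - lam * v x) := by
    rw [← hflux, hkey]; positivity
  have hgint : IntervalIntegrable g volume r s :=
    (hg.mono (by rw [uIcc_of_le hrs]; exact Icc_subset_Icc hr0 hs.2)).intervalIntegrable
  rw [intervalIntegral.integral_sub hgint ((hv.intervalIntegrable _ _).const_mul lam),
    intervalIntegral.integral_const_mul] at hpos
  have hgle : ∫ x in r..s, g x ≤ h * G := by
    calc ∫ x in r..s, g x ≤ ∫ x in r..s, G :=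
          intervalIntegral.integral_mono_on hrs hgint (by simp)
            fun x hx => hG x ⟨hr0.trans hx.1, hx.2.trans hs.2⟩
      _ = (s - r) * G := by simp
      _ ≤ h * G := mul_le_mul_of_nonneg_right hrh hG0
  have hvint : ∫ x in (s - h)..s, v x = ∫ x in r..s, v x := by
    rw [← intervalIntegral.integral_add_adjacent_intervals (b := r)
      (hv.intervalIntegrable _ _) (hv.intervalIntegrable _ _)]
    have : ∫ x in (s - h)..r, v x = 0 := by
      rcases le_total (s - h) 0 with hc | hc
      · rw [intervalIntegral.integral_congr (g := fun _ => (0 : ℝ)) fun x hx => ?_]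
        · simp
        · rw [uIcc_of_le (le_max_left _ _)] at hx
          exact hv0 x (hx.2.trans_eq (max_eq_right hc))
      · rw [hr, max_eq_left hc, intervalIntegral.integral_same]
    rw [this, zero_add]
  rw [hyint, hvint, le_div_iff₀ hlam]
  have : h⁻¹ * (h * G) = G := by field_simp
  nlinarith [mul_le_mul_of_nonneg_left (show lam * ∫ x in r..s, v x ≤ h * G by linarith)
    (inv_nonneg.2 hh.le)]

lemma le_of_hasRLDerivAt {α t lam G : ℝ} (hα0 : 0 < α) (hα1 : α < 1) (ht : 0 < t)
    (hlam : 0 < lam) (hG0 : 0 ≤ G) {v g : ℝ → ℝ} (hv : ContinuousOn v (Icc 0 t))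
    (hv0 : v 0 = 0) (hg : ContinuousOn g (Icc 0 t))
    (hD : ∀ s ∈ Ioc 0 t, HasRLDerivAt α t v (g s - lam * v s) s)
    (hG : ∀ s ∈ Icc 0 t, g s ≤ G) :
    v t ≤ G / lam := by
  set w : ℝ → ℝ := IccExtend ht.le ((Icc 0 t).domRestrict v) with hw
  have hwc : Continuous w := hv.domRestrict.Icc_extend'
  have hwv : ∀ x ∈ Icc 0 t, w x = v x := fun x hx => by
    rw [hw, IccExtend_of_mem _ _ hx]; rfl
  have hw0 : ∀ x ≤ 0, w x = 0 := fun x hx => by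
    rw [hw, IccExtend_of_le_left _ _ hx]; exact hv0
  have hI : ∀ s ∈ Icc 0 t, rlIntegral α w s = rlIntegral α v s := by
    intro s hs
    simp only [rlIntegral]
    congr 1
    refine intervalIntegral.integral_congr fun x hx => ?_
    rw [uIcc_of_le hs.1] at hx
    simp only [hwv x ⟨hx.1, hx.2.trans hs.2⟩]
  have hDw : ∀ s ∈ Ioc 0 t, HasRLDerivAt α t w (g s - lam * w s) s := by
    intro s hs
    have hs' : s ∈ Icc 0 t := Ioc_subset_Icc_self hs
    rw [hwv s hs']
    exact HasDerivWithinAt.congr (hD s hs) hI (hI s hs')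
  have hmean := fun h (hh : 0 < h) =>
    mean_le_of_hasRLDerivAt hα0 hα1 ht hlam hG0 hh hwc hw0 hg hDw hG
  rw [← hwv t (right_mem_Icc.2 ht.le)]
  have hder := (hwc.integral_hasStrictDerivAt 0 t).hasDerivAt
  have hs := (hasDerivAt_iff_tendsto_slope.1 hder).mono_left
    (nhdsWithin_mono t fun x (hx : x ∈ Iio t) => ne_of_lt hx)
  refine le_of_tendsto hs (eventually_nhdsWithin_of_forall fun x (hx : x < t) => ?_)
  have h := hmean (t - x) (by linarith)
  rw [sub_sub_cancel, ← intervalIntegral.integral_interval_sub_left (a := 0)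
    (hwc.intervalIntegrable _ _) (hwc.intervalIntegrable _ _)] at h
  rwa [slope_comm, slope_def_field, div_eq_inv_mul]

/-- The maximum principle: a solution of `∂_t^α v + lam v = g`, `v(0) = 0`, is bounded by
`lam⁻¹ sup |g|`. -/
lemma abs_le_of_hasRLDerivAt {α t lam G : ℝ} (hα0 : 0 < α) (hα1 : α < 1) (ht : 0 < t)
    (hlam : 0 < lam) {v g : ℝ → ℝ} (hv : ContinuousOn v (Icc 0 t))
    (hv0 : v 0 = 0) (hg : ContinuousOn g (Icc 0 t))
    (hD : ∀ s ∈ Ioc 0 t, HasRLDerivAt α t v (g s - lam * v s) s)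
    (hG : ∀ s ∈ Icc 0 t, |g s| ≤ G) :
    ∀ s ∈ Icc 0 t, |v s| ≤ G / lam := by
  intro s hs
  have hG0 : 0 ≤ G := (abs_nonneg _).trans (hG 0 (left_mem_Icc.2 ht.le))
  rcases hs.1.eq_or_lt with rfl | hs0
  · rw [hv0, abs_zero]; positivity
  have hsub : Icc 0 s ⊆ Icc 0 t := Icc_subset_Icc le_rfl hs.2
  have hDs : ∀ x ∈ Ioc 0 s, HasRLDerivAt α s v (g x - lam * v x) x :=
    fun x hx => (hD x ⟨hx.1, hx.2.trans hs.2⟩).mono hs.2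
  refine abs_le'.2 ⟨le_of_hasRLDerivAt hα0 hα1 hs0 hlam hG0 (hv.mono hsub) hv0 (hg.mono hsub) hDs
    fun x hx => (abs_le.1 (hG x (hsub hx))).2, ?_⟩
  refine le_of_hasRLDerivAt (v := fun x => -v x) (g := fun x => -g x) hα0 hα1 hs0 hlam hG0
    (hv.mono hsub).neg (by simp [hv0]) (hg.mono hsub).neg (fun x hx => ?_)
    fun x hx => by linarith [(abs_le.1 (hG x (hsub hx))).1]
  have h := (hDs x hx).neg
  have hfun : rlIntegral α (fun x => -v x) = -rlIntegral α v := by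
    ext z; simp [rlIntegral]
  rw [HasRLDerivAt, hfun]
  convert h using 1
  ring

/-- Two solutions with the same right-hand side and different coefficients `lam`, `mu`. -/
lemma abs_sub_le_of_hasRLDerivAt {α t lam mu G : ℝ} (hα0 : 0 < α) (hα1 : α < 1) (ht : 0 < t)
    (hlam : 0 < lam) (hmu : 0 < mu) {v w g : ℝ → ℝ} (hv : ContinuousOn v (Icc 0 t))
    (hw : ContinuousOn w (Icc 0 t)) (hv0 : v 0 = 0) (hw0 : w 0 = 0)
    (hg : ContinuousOn g (Icc 0 t))
    (hDv : ∀ s ∈ Ioc 0 t, HasRLDerivAt α t v (g s - lam * v s) s)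
    (hDw : ∀ s ∈ Ioc 0 t, HasRLDerivAt α t w (g s - mu * w s) s)
    (hG : ∀ s ∈ Icc 0 t, |g s| ≤ G) :
    |v t - w t| ≤ |lam - mu| / (lam * mu) * G := by
  have hbw := abs_le_of_hasRLDerivAt hα0 hα1 ht hmu hw hw0 hg hDw hG
  have h := abs_le_of_hasRLDerivAt (v := fun s => v s - w s) (g := fun s => (mu - lam) * w s)
    (G := |lam - mu| * (G / mu)) hα0 hα1 ht hlam (hv.sub hw) (by simp [hv0, hw0])
    (continuousOn_const.mul hw) (fun s hs => ?_) (fun s hs => ?_) t (right_mem_Icc.2 ht.le)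
  · refine h.trans_eq ?_
    field_simp
  · have h := (hDv s hs).sub (hDw s hs)
    have hfun : ∀ x ∈ Icc 0 t, rlIntegral α (fun s => v s - w s) x =
        (rlIntegral α v - rlIntegral α w) x := by
      intro x hx
      have hsub : uIcc 0 x ⊆ Icc 0 t := by
        rw [uIcc_of_le hx.1]; exact Icc_subset_Icc le_rfl hx.2
      simp only [rlIntegral, smul_eq_mul, Pi.sub_apply]
      rw [← mul_sub, ← intervalIntegral.integral_sub
        ((intervalIntegrable_sub_rpow hα1 x 0 x).mul_continuousOn (hv.mono hsub))
        ((intervalIntegrable_sub_rpow hα1 x 0 x).mul_continuousOn (hw.mono hsub))]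
      simp only [mul_sub]
    refine HasDerivWithinAt.congr ?_ hfun (hfun s (Ioc_subset_Icc_self hs))
    convert h using 1
    ring
  · rw [abs_mul, abs_sub_comm]
    exact mul_le_mul_of_nonneg_left (hbw s hs) (abs_nonneg _)

/-! ## Sine coefficients -/

lemma continuous_phi (k : ℕ) : Continuous (phi k) := by
  unfold phi; fun_prop

lemma abs_phi_le (k : ℕ) (x : ℝ) : |phi k x| ≤ √2 := by
  rw [phi, abs_mul, abs_of_nonneg (Real.sqrt_nonneg 2)]
  exact mul_le_of_le_one_right (Real.sqrt_nonneg 2) (Real.abs_sin_le_one _)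

lemma memLp_phi (k : ℕ) : MemLp (phi k) 2 (volume.restrict Omega) :=
  MemLp.of_bound (continuous_phi k).aestronglyMeasurable (√2) (Eventually.of_forall (abs_phi_le k))

/-- The coefficient `v ↦ (v, φ_k)` as a continuous linear functional. -/
noncomputable def coefL (k : ℕ) : L2 →L[ℝ] ℝ := innerSL ℝ (memLp_phi k).toLp

lemma coefL_apply (k : ℕ) (v : L2) : coefL k v = coef v k := by
  rw [coefL, innerSL_apply_apply, L2.inner_def, coef]
  refine integral_congr_ae ?_
  filter_upwards [(memLp_phi k).coeFn_toLp] with x hx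
  rw [hx]; rfl

lemma coef_zero (k : ℕ) : coef 0 k = 0 := by rw [← coefL_apply, map_zero]

/-- The sine coefficient of a function on `[0,1]`. -/
noncomputable def sineCoef (v : ℝ → ℝ) (k : ℕ) : ℝ := ∫ x in (0 : ℝ)..1, v x * phi k x

lemma coef_eq_sineCoef (v : L2) (k : ℕ) : coef v k = sineCoef v k := by
  rw [coef, sineCoef, intervalIntegral.integral_of_le zero_le_one,
    integral_Ioc_eq_integral_Ioo]

lemma coef_eq_sineCoef_of_ae {v : L2} {w : ℝ → ℝ} (h : (v : ℝ → ℝ) =ᵐ[volume.restrict Omega] w)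
    (k : ℕ) : coef v k = sineCoef w k := by
  rw [coef, sineCoef, intervalIntegral.integral_of_le zero_le_one,
    integral_Ioc_eq_integral_Ioo]
  exact integral_congr_ae (h.mono fun x hx => by simp only [hx])

lemma phi_zero_right (k : ℕ) : phi k 0 = 0 := by simp [phi]

lemma phi_one_right (k : ℕ) : phi k 1 = 0 := by simp [phi, Real.sin_nat_mul_pi]

lemma L2.intervalIntegrable (g : L2) : IntervalIntegrable g volume 0 1 := by
  rw [intervalIntegrable_iff_integrableOn_Ioo_of_le zero_le_one]
  exact (Lp.memLp g).integrable (by norm_num)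

lemma IsDirichletLaplacian.continuousOn {v : ℝ → ℝ} {g : L2} (h : IsDirichletLaplacian v g) :
    ContinuousOn v (Icc 0 1) := by
  obtain ⟨-, -, v', hv, hv'⟩ := h
  have hg := L2.intervalIntegrable g
  have h1 : ContinuousOn v' (Icc 0 1) := by
    have := intervalIntegral.continuousOn_primitive_interval' hg left_mem_uIcc
    rw [uIcc_of_le zero_le_one] at this
    exact (continuousOn_const.sub this).congr hv'
  have := intervalIntegral.continuousOn_primitive_interval' (a := (0 : ℝ))
    (ContinuousOn.intervalIntegrable (μ := volume) (by rwa [uIcc_of_le (zero_le_one' ℝ)]))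
    left_mem_uIcc
  rw [uIcc_of_le zero_le_one] at this
  exact (continuousOn_const.add this).congr hv

lemma IsDirichletLaplacian.coef_eq {v : ℝ → ℝ} {g : L2} (h : IsDirichletLaplacian v g) (k : ℕ) :
    coef g k = lam k * sineCoef v k := by
  have hvc := h.continuousOn
  obtain ⟨hv0, hv1, v', hv, hv'⟩ := h
  have hg := L2.intervalIntegrable g
  set P : ℝ → ℝ := fun x => v' 0 - ∫ y in (0 : ℝ)..x, g y with hP
  have hPc : ContinuousOn P (Icc 0 1) := by
    have := intervalIntegral.continuousOn_primitive_interval' hg left_mem_uIcc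
    rw [uIcc_of_le zero_le_one] at this
    exact continuousOn_const.sub this
  have hPac : AbsolutelyContinuousOnInterval P 0 1 := by
    have h1 : AbsolutelyContinuousOnInterval (fun _ : ℝ => v' 0) 0 1 :=
      (LipschitzWith.const (v' 0)).lipschitzOnWith.absolutelyContinuousOnInterval
    exact h1.sub (hg.absolutelyContinuousOnInterval_intervalIntegral (by simp))
  set ψ : ℝ → ℝ := fun x => √2 * (k * Real.pi) * Real.cos (k * Real.pi * x) with hψ
  have hψc : Continuous ψ := by fun_prop
  have hφd : ∀ x, HasDerivAt (phi k) (ψ x) x := by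
    intro x
    have := (((hasDerivAt_id' x).const_mul ((k : ℝ) * Real.pi)).sin).const_mul √2
    exact this.congr_deriv (by simp only [hψ]; ring)
  have hψd : ∀ x, HasDerivAt ψ (-(lam k * phi k x)) x := by
    intro x
    have := (((hasDerivAt_id' x).const_mul ((k : ℝ) * Real.pi)).cos).const_mul
      (√2 * (k * Real.pi))
    exact this.congr_deriv (by simp only [lam, phi]; ring)
  have hφac : AbsolutelyContinuousOnInterval (phi k) 0 1 := by
    refine ContDiffOn.absolutelyContinuousOnInterval (ContDiff.contDiffOn ?_)
    unfold phi; fun_prop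
  have hparts := hφac.integral_mul_deriv_eq_deriv_mul hPac
  rw [phi_zero_right, phi_one_right, zero_mul, zero_mul, sub_zero, zero_sub] at hparts
  have hL : ∫ x in (0 : ℝ)..1, phi k x * deriv P x = -coef g k := by
    rw [coef_eq_sineCoef, sineCoef, ← intervalIntegral.integral_neg]
    refine intervalIntegral.integral_congr_ae ?_
    filter_upwards [hg.ae_hasDerivAt_integral] with x hx hxm
    have := (hx (uIoc_subset_uIcc hxm) 0 (by simp)).const_sub (v' 0)
    rw [this.deriv]; ring
  have hv'P : EqOn v' P (Icc 0 1) := hv'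
  have hvd : ∀ x ∈ Ioo (0 : ℝ) 1, HasDerivAt v (P x) x := by
    intro x hx
    have hc : ContinuousOn v' (Icc 0 1) := hPc.congr hv'P
    have hx' : Icc (0 : ℝ) 1 ∈ 𝓝 x := Icc_mem_nhds hx.1 hx.2
    have hi : IntervalIntegrable v' volume 0 x := by
      refine ContinuousOn.intervalIntegrable (hc.mono ?_)
      rw [uIcc_of_le hx.1.le]; exact Icc_subset_Icc le_rfl hx.2.le
    have h1 := intervalIntegral.integral_hasDerivAt_right hi
      (hc.stronglyMeasurableAtFilter_nhdsWithin measurableSet_Icc x |>.filter_mono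
        (by rw [nhdsWithin_eq_nhds.2 hx'])) (hc.continuousAt hx')
    rw [← hv'P (Ioo_subset_Icc_self hx)]
    refine (h1.const_add (v 0)).congr_of_eventuallyEq ?_
    filter_upwards [hx'] with y hy using hv y hy
  have hparts2 := intervalIntegral.integral_mul_deriv_eq_deriv_mul_of_hasDerivAt (a := 0) (b := 1)
    (u := ψ) (v := v) (u' := fun x => -(lam k * phi k x)) (v' := P) hψc.continuousOn
    (by rwa [uIcc_of_le zero_le_one]) (fun x _ => hψd x)
    (fun x hx => hvd x (by simpa using hx))
    ((continuous_const.mul (continuous_phi k)).neg.intervalIntegrable _ _)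
    (ContinuousOn.intervalIntegrable (by rwa [uIcc_of_le zero_le_one]))
  rw [hv0, hv1, mul_zero, mul_zero, sub_zero, zero_sub] at hparts2
  have hR : ∫ x in (0 : ℝ)..1, deriv (phi k) x * P x = lam k * sineCoef v k := by
    simp only [(hφd _).deriv]
    rw [hparts2, ← intervalIntegral.integral_neg, sineCoef, ← intervalIntegral.integral_const_mul]
    congr 1; ext x; ring
  rw [hL, hR] at hparts
  linarith

lemma hasSum_sineCoef {v : ℝ → ℝ} (hv : ContinuousOn v (Icc 0 1)) (hv0 : v 0 = 0) (hv1 : v 1 = 0)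
    (hsum : Summable (sineCoef v)) {x : ℝ} (hx : x ∈ Icc (0 : ℝ) 1) :
    HasSum (fun k : ℕ => sineCoef v k * phi k x) (v x) := by
  have : Fact ((0 : ℝ) < 2) := ⟨two_pos⟩
  set f : ℝ → ℂ := fun y => if y ≤ 0 then -(v (-y) : ℂ) else (v y : ℂ) with hf
  have hfneg : ∀ y ≤ 0, f y = -(v (-y) : ℂ) := fun y hy => by simp [hf, hy]
  have hfpos : ∀ y, 0 ≤ y → f y = (v y : ℂ) := fun y hy => by
    rcases hy.eq_or_lt with rfl | h
    · simp [hf, hv0]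
    · simp [hf, not_le.2 h]
  have hfc : ContinuousOn f (Icc (-1) (-1 + 2)) := by
    have h1 : ContinuousOn f (Icc (-1) 0) := by
      refine ContinuousOn.congr (f := fun y => -(v (-y) : ℂ)) ?_ fun y hy => hfneg y hy.2
      refine (Complex.continuous_ofReal.comp_continuousOn (hv.comp continuousOn_neg ?_)).neg
      intro y hy; exact ⟨by linarith [hy.2], by linarith [hy.1]⟩
    have h2 : ContinuousOn f (Icc 0 (-1 + 2)) := by
      refine ContinuousOn.congr (f := fun y => (v y : ℂ)) ?_ fun y hy => hfpos y hy.1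
      refine Complex.continuous_ofReal.comp_continuousOn (hv.mono ?_)
      norm_num
    have := h1.union_of_isClosed h2 isClosed_Icc isClosed_Icc
    rwa [Icc_union_Icc_eq_Icc (by norm_num) (by norm_num)] at this
  have hfend : f (-1) = f (-1 + 2) := by
    rw [hfneg _ (by norm_num), hfpos _ (by norm_num)]; norm_num [hv1]
  set F : C(AddCircle (2 : ℝ), ℂ) :=
    ⟨AddCircle.liftIco 2 (-1) f, AddCircle.liftIco_continuous hfend hfc⟩ with hF
  have hFf : ∀ y ∈ Icc (-1 : ℝ) 1, F (y : AddCircle (2 : ℝ)) = f y := by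
    intro y hy
    rcases hy.2.eq_or_lt with rfl | h
    · have : ((1 : ℝ) : AddCircle (2 : ℝ)) = ((-1 : ℝ) : AddCircle (2 : ℝ)) := by
        rw [← AddCircle.coe_add_period 2 (-1)]; norm_num
      rw [this, hF, ContinuousMap.coe_mk, AddCircle.liftIco_coe_apply (by norm_num), hfend]
      norm_num
    · rw [hF, ContinuousMap.coe_mk, AddCircle.liftIco_coe_apply ⟨hy.1, by linarith⟩]
  set S : ℤ → ℝ := fun n => ∫ y in (0 : ℝ)..1, v y * Real.sin (n * Real.pi * y) with hS
  have hfour : ∀ (n : ℤ) (y : ℝ), fourier n (y : AddCircle (2 : ℝ)) =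
      (Real.cos (n * Real.pi * y) : ℂ) + (Real.sin (n * Real.pi * y) : ℂ) * Complex.I := by
    intro n y
    rw [fourier_coe_apply, Complex.ofReal_cos, Complex.ofReal_sin, ← Complex.exp_mul_I]
    congr 1; push_cast; ring
  have hcoef : ∀ n, fourierCoeff F n = -Complex.I * S n := by
    intro n
    have hint : ∀ a b : ℝ, a ∈ Icc (-1 : ℝ) 1 → b ∈ Icc (-1 : ℝ) 1 → IntervalIntegrable
        (fun y : ℝ => fourier (-n) (y : AddCircle (2 : ℝ)) • F (y : AddCircle (2 : ℝ))) volume a b := by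
      intro a b ha hb
      refine Continuous.intervalIntegrable ?_ _ _
      exact ((fourier (-n)).continuous.smul F.continuous).comp (AddCircle.continuous_mk' 2)
    rw [fourierCoeff_eq_intervalIntegral _ _ (-1), show (-1 : ℝ) + 2 = 1 by norm_num,
      ← intervalIntegral.integral_add_adjacent_intervals (b := 0)
        (hint _ _ (by norm_num) (by norm_num)) (hint _ _ (by norm_num) (by norm_num))]
    have h1 : ∫ y in (-1 : ℝ)..0, fourier (-n) (y : AddCircle (2 : ℝ)) • F (y : AddCircle (2 : ℝ)) =
        ∫ y in (0 : ℝ)..1, fourier (-n) ((-y : ℝ) : AddCircle (2 : ℝ)) •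
          F ((-y : ℝ) : AddCircle (2 : ℝ)) := by
      rw [intervalIntegral.integral_comp_neg
        (fun y : ℝ => fourier (-n) (y : AddCircle (2 : ℝ)) • F (y : AddCircle (2 : ℝ))), neg_zero]
    have hi2 : IntervalIntegrable (fun y : ℝ => fourier (-n) ((-y : ℝ) : AddCircle (2 : ℝ)) •
        F ((-y : ℝ) : AddCircle (2 : ℝ))) volume 0 1 := by
      refine Continuous.intervalIntegrable ?_ _ _
      exact (((fourier (-n)).continuous.smul F.continuous).comp (AddCircle.continuous_mk' 2)).comp
        continuous_neg
    rw [h1, ← intervalIntegral.integral_add hi2 (hint _ _ (by norm_num) (by norm_num))]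
    have h2 : ∫ y in (0 : ℝ)..1, (fourier (-n) ((-y : ℝ) : AddCircle (2 : ℝ)) •
        F ((-y : ℝ) : AddCircle (2 : ℝ)) +
        fourier (-n) (y : AddCircle (2 : ℝ)) • F (y : AddCircle (2 : ℝ))) =
        ∫ y in (0 : ℝ)..1, (-2 * Complex.I) * ((v y * Real.sin (n * Real.pi * y) : ℝ) : ℂ) := by
      refine intervalIntegral.integral_congr fun y hy => ?_
      rw [uIcc_of_le zero_le_one] at hy
      simp only [smul_eq_mul]
      rw [hFf y ⟨by linarith [hy.1], hy.2⟩, hFf (-y) ⟨by linarith [hy.2], by linarith [hy.1]⟩,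
        hfpos y hy.1, hfneg (-y) (by linarith [hy.1]), neg_neg, hfour, hfour]
      have e1 : ((-n : ℤ) : ℝ) * Real.pi * -y = n * Real.pi * y := by push_cast; ring
      have e2 : ((-n : ℤ) : ℝ) * Real.pi * y = -(n * Real.pi * y) := by push_cast; ring
      rw [e1, e2, Real.cos_neg, Real.sin_neg]
      push_cast; ring
    rw [h2, intervalIntegral.integral_const_mul, intervalIntegral.integral_ofReal, Complex.real_smul]
    push_cast; ring
  have hSneg : ∀ n, S (-n) = -S n := by
    intro n
    simp only [hS]
    rw [← intervalIntegral.integral_neg]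
    congr 1; ext y
    rw [show ((-n : ℤ) : ℝ) * Real.pi * y = -(n * Real.pi * y) by push_cast; ring, Real.sin_neg]
    ring
  have hSk : ∀ k : ℕ, sineCoef v k = √2 * S k := by
    intro k
    simp only [hS, sineCoef, phi]
    rw [← intervalIntegral.integral_const_mul]
    congr 1; ext y; push_cast; ring
  have hs2 : √2 * √2 = 2 := Real.mul_self_sqrt (by norm_num)
  have hSsum : Summable fun k : ℕ => S k := by
    have : (fun k : ℕ => S k) = fun k => (√2)⁻¹ * sineCoef v k := by
      ext k; rw [hSk]; field_simp
    rw [this]; exact hsum.mul_left _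
  have hsumF : Summable (fourierCoeff F) := by
    have : fourierCoeff F = fun n => -Complex.I * S n := funext hcoef
    rw [this]
    refine Summable.mul_left _ ?_
    refine Summable.of_nat_of_neg (Complex.summable_ofReal.2 hSsum) ?_
    simp only [hSneg, Complex.ofReal_neg]
    exact (Complex.summable_ofReal.2 hSsum).neg
  have hpt := (has_pointwise_sum_fourier_series_of_summable hsumF (x : AddCircle (2 : ℝ))).nat_add_neg
  rw [hFf x ⟨by linarith [hx.1], hx.2⟩, hfpos x hx.1] at hpt
  have hS0 : S 0 = 0 := by simp [hS]
  simp only [hcoef, hSneg, hfour, smul_eq_mul, hS0, Complex.ofReal_zero, mul_zero, zero_mul,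
    add_zero] at hpt
  rw [← Complex.hasSum_ofReal]
  convert hpt using 2 with k
  rw [hSk, phi]
  have e2 : ((-k : ℤ) : ℝ) * Real.pi * x = -(k * Real.pi * x) := by push_cast; ring
  rw [e2, Real.cos_neg, Real.sin_neg]
  have hs2' : (√2 : ℂ) * (√2 : ℂ) = 2 := by exact_mod_cast congrArg (fun z : ℝ => (z : ℂ)) hs2
  push_cast
  linear_combination (S k * Complex.sin (k * Real.pi * x) : ℂ) * hs2' +
    2 * S k * Complex.sin (k * Real.pi * x) * Complex.I_sq

/-! ## The discrete sine transform -/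

lemma sum_cos_mul {θ : ℝ} (hθ : Real.sin (θ / 2) ≠ 0) (n : ℕ) :
    ∑ i ∈ Finset.range n, Real.cos (i * θ) =
      (Real.sin ((n - 1 / 2) * θ) + Real.sin (θ / 2)) / (2 * Real.sin (θ / 2)) := by
  rw [eq_div_iff (by positivity)]
  induction n with
  | zero =>
    rw [show ((0 : ℕ) - 1 / 2 : ℝ) * θ = -(θ / 2) by push_cast; ring, Real.sin_neg]; simp
  | succ n ih =>
    rw [Finset.sum_range_succ, add_mul, ih]
    have e1 : ((n + 1 : ℕ) - 1 / 2 : ℝ) * θ = n * θ + θ / 2 := by push_cast; ring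
    have e2 : ((n : ℝ) - 1 / 2) * θ = n * θ - θ / 2 := by ring
    rw [e1, e2, Real.sin_add, Real.sin_sub]; ring

lemma sum_cos_nat_mul_pi_div {N m : ℕ} (hm : 0 < m) (hmN : m < 2 * N) :
    ∑ i ∈ Finset.range N, Real.cos (i * (m * Real.pi / N)) = (1 - (-1) ^ m) / 2 := by
  have hN : (0 : ℝ) < N := by exact_mod_cast (by omega : 0 < N)
  have hm' : (0 : ℝ) < m := by exact_mod_cast hm
  have hmN' : (m : ℝ) < 2 * N := by exact_mod_cast hmN
  have hsin : 0 < Real.sin (m * Real.pi / N / 2) := by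
    refine Real.sin_pos_of_pos_of_lt_pi (by positivity) ?_
    rw [div_div, div_lt_iff₀ (by positivity)]
    nlinarith [Real.pi_pos]
  rw [sum_cos_mul hsin.ne']
  have e : ((N : ℝ) - 1 / 2) * (m * Real.pi / N) = m * Real.pi - m * Real.pi / N / 2 := by
    field_simp
  rw [e, Real.sin_nat_mul_pi_sub, div_eq_div_iff (by positivity) two_ne_zero]
  ring

/-- Discrete orthogonality of the sine functions. -/
lemma sum_sin_mul_sin {N k l : ℕ} (hk : k ∈ Finset.Icc 1 (N - 1)) (hl : l ∈ Finset.Icc 1 (N - 1)) :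
    ∑ i ∈ Finset.range N, Real.sin (i * (k * Real.pi / N)) * Real.sin (i * (l * Real.pi / N)) =
      if k = l then (N : ℝ) / 2 else 0 := by
  rw [Finset.mem_Icc] at hk hl
  wlog hkl : l ≤ k generalizing k l
  · simp only [eq_comm (a := k)]
    rw [← this hl hk (by omega)]
    exact Finset.sum_congr rfl fun i _ => mul_comm _ _
  have h1 : ∀ i : ℕ, Real.sin (i * (k * Real.pi / N)) * Real.sin (i * (l * Real.pi / N)) =
      (Real.cos (i * ((k - l : ℕ) * Real.pi / N)) - Real.cos (i * ((k + l : ℕ) * Real.pi / N))) / 2 := by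
    intro i
    have e1 : (i : ℝ) * ((k - l : ℕ) * Real.pi / N) =
        i * (k * Real.pi / N) - i * (l * Real.pi / N) := by push_cast [hkl]; ring
    have e2 : (i : ℝ) * ((k + l : ℕ) * Real.pi / N) =
        i * (k * Real.pi / N) + i * (l * Real.pi / N) := by push_cast; ring
    rw [e1, e2, Real.cos_sub, Real.cos_add]; ring
  simp only [h1]
  rw [← Finset.sum_div, Finset.sum_sub_distrib,
    sum_cos_nat_mul_pi_div (m := k + l) (by omega) (by omega)]
  split_ifs with h
  · subst h
    simp [← two_mul, pow_mul]
  · rw [sum_cos_nat_mul_pi_div (m := k - l) (by omega) (by omega)]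
    have : (-1 : ℝ) ^ (k + l) = (-1) ^ (k - l) := by
      rw [show k + l = k - l + 2 * l by omega, pow_add, pow_mul]; simp
    rw [this]; simp

lemma sum_node {N : ℕ} (F : ℕ → ℝ) :
    ∑ i : Fin (N - 1), F (i + 1) = ∑ m ∈ Finset.Icc 1 (N - 1), F m := by
  rw [Fin.sum_univ_eq_sum_range (fun i => F (i + 1)), Finset.range_eq_Ico,
    Finset.sum_Ico_add' F 0 (N - 1) 1]
  rfl

lemma pos_of_fin {N : ℕ} (i : Fin (N - 1)) : 0 < N := by
  have := i.isLt; omega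

lemma node_eq {N : ℕ} (i : Fin (N - 1)) : node N i = ((i + 1 : ℕ) : ℝ) / N := by
  simp [node]

lemma node_mem {N : ℕ} (i : Fin (N - 1)) : node N i ∈ Icc (0 : ℝ) 1 := by
  have hN : (0 : ℝ) < N := by exact_mod_cast pos_of_fin i
  rw [node_eq]
  refine ⟨by positivity, (div_le_one hN).2 ?_⟩
  exact_mod_cast (by have := i.isLt; omega : (i : ℕ) + 1 ≤ N)

lemma sum_phi_mul_phi_div {N k l : ℕ} (hk : k ∈ Finset.Icc 1 (N - 1))
    (hl : l ∈ Finset.Icc 1 (N - 1)) :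
    ∑ m ∈ Finset.Icc 1 (N - 1), phi k ((m : ℝ) / N) * phi l ((m : ℝ) / N) =
      if k = l then (N : ℝ) else 0 := by
  have h := sum_sin_mul_sin hk hl
  rw [Finset.mem_Icc] at hk
  have hs2 : √2 * √2 = (2 : ℝ) := Real.mul_self_sqrt (by norm_num)
  have h2 : ∀ m : ℕ, phi k ((m : ℝ) / N) * phi l ((m : ℝ) / N) =
      2 * (Real.sin (m * (k * Real.pi / N)) * Real.sin (m * (l * Real.pi / N))) := by
    intro m
    have e : ∀ k : ℕ, (k : ℝ) * Real.pi * (m / N) = m * (k * Real.pi / N) := fun k => by ring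
    rw [phi, phi, e, e]
    linear_combination Real.sin (m * (k * Real.pi / N)) * Real.sin (m * (l * Real.pi / N)) * hs2
  simp only [h2]
  rw [← Finset.mul_sum]
  have h3 : ∑ m ∈ Finset.Icc 1 (N - 1),
      Real.sin (m * (k * Real.pi / N)) * Real.sin (m * (l * Real.pi / N)) =
      if k = l then (N : ℝ) / 2 else 0 := by
    rw [← h, ← sum_node (fun m : ℕ => Real.sin (m * (k * Real.pi / N)) *
      Real.sin (m * (l * Real.pi / N)))]
    obtain ⟨M, rfl⟩ : ∃ M, N = M + 1 := ⟨N - 1, by omega⟩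
    rw [Finset.sum_range_succ', Nat.add_sub_cancel, Fin.sum_univ_eq_sum_range
      (fun i : ℕ => Real.sin (((i + 1 : ℕ) : ℝ) * (k * Real.pi / (M + 1 : ℕ))) *
      Real.sin (((i + 1 : ℕ) : ℝ) * (l * Real.pi / (M + 1 : ℕ))))]
    simp
  rw [h3]
  split_ifs <;> ring

lemma sum_phi_mul_phi_node {N k l : ℕ} (hk : k ∈ Finset.Icc 1 (N - 1))
    (hl : l ∈ Finset.Icc 1 (N - 1)) :
    ∑ i, phi k (node N i) * phi l (node N i) = if k = l then (N : ℝ) else 0 := by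
  rw [← sum_phi_mul_phi_div hk hl, ← sum_node]
  simp only [node_eq]

lemma phi_node_comm {N : ℕ} (k : ℕ) (i : Fin (N - 1)) :
    phi k (node N i) = phi (i + 1) ((k : ℝ) / N) := by
  rw [phi, phi, node_eq]; congr 2; ring

/-- The discrete sine coefficient of a vector of nodal values. -/
noncomputable def dst (N k : ℕ) (w : Fin (N - 1) → ℝ) : ℝ :=
  (N : ℝ)⁻¹ * ∑ i, phi k (node N i) * w i

lemma sum_dst_mul_phi {N : ℕ} (w : Fin (N - 1) → ℝ) (i : Fin (N - 1)) :
    ∑ k ∈ Finset.Icc 1 (N - 1), dst N k w * phi k (node N i) = w i := by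
  have hN : (N : ℝ) ≠ 0 := by exact_mod_cast (pos_of_fin i).ne'
  have hmem : ∀ j : Fin (N - 1), (j : ℕ) + 1 ∈ Finset.Icc 1 (N - 1) := fun j => by
    rw [Finset.mem_Icc]; omega
  calc ∑ k ∈ Finset.Icc 1 (N - 1), dst N k w * phi k (node N i)
      = (N : ℝ)⁻¹ * ∑ j, w j * ∑ k ∈ Finset.Icc 1 (N - 1),
          phi (j + 1) ((k : ℝ) / N) * phi (i + 1) ((k : ℝ) / N) := by
        simp only [dst, Finset.mul_sum, Finset.sum_mul]
        rw [Finset.sum_comm]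
        refine Finset.sum_congr rfl fun j _ => Finset.sum_congr rfl fun k _ => ?_
        rw [phi_node_comm, phi_node_comm]; ring
    _ = (N : ℝ)⁻¹ * ∑ j, w j * if j = i then (N : ℝ) else 0 := by
        congr 1
        refine Finset.sum_congr rfl fun j _ => ?_
        rw [sum_phi_mul_phi_div (hmem j) (hmem i)]
        simp only [add_left_inj, Fin.ext_iff]
    _ = w i := by
        simp only [mul_ite, mul_zero, Finset.sum_ite_eq', Finset.mem_univ, if_true]
        field_simp

/-- The discrete eigenvalue `4N² sin²(kπ/(2N))`. -/
noncomputable def lamh (N k : ℕ) : ℝ := 4 * (N : ℝ) ^ 2 * Real.sin (k * Real.pi / (2 * N)) ^ 2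

lemma sum_diffWeight_mul {M : ℕ} (F : ℕ → ℝ) (h0 : F 0 = 0) (hM : F (M + 1) = 0) (j : Fin M) :
    ∑ i, diffWeight i j * F (i + 1) = 2 * F (j + 1) - F j - F (j + 2) := by
  have hW : ∀ i : Fin M, diffWeight i j * F (i + 1) = (if i = j then 2 * F (i + 1) else 0) -
      (if (i : ℕ) + 1 = j then F (i + 1) else 0) - (if (i : ℕ) = j + 1 then F (i + 1) else 0) := by
    intro i
    rw [diffWeight]
    split_ifs <;> first | (exfalso; omega) | ring
  simp only [hW]
  rw [Finset.sum_sub_distrib, Finset.sum_sub_distrib, Finset.sum_ite_eq' Finset.univ j]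
  have h1 : ∑ i : Fin M, (if (i : ℕ) + 1 = j then F (i + 1) else 0) = F j := by
    rcases Nat.eq_zero_or_pos (j : ℕ) with hj | hj
    · rw [hj, h0]; simp
    · rw [Finset.sum_eq_single (⟨j - 1, by omega⟩ : Fin M)]
      · rw [if_pos (by simp; omega)]; congr 1; simp; omega
      · intro i _ hi
        rw [if_neg]
        contrapose! hi
        ext; simp; omega
      · simp
  have h2 : ∑ i : Fin M, (if (i : ℕ) = j + 1 then F (i + 1) else 0) = F (j + 2) := by
    by_cases hj : (j : ℕ) + 1 < M
    · rw [Finset.sum_eq_single (⟨j + 1, hj⟩ : Fin M)]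
      · simp
      · intro i _ hi
        rw [if_neg]
        contrapose! hi
        ext; simp; omega
      · simp
    · rw [show (j : ℕ) + 2 = M + 1 by omega, hM]
      refine Finset.sum_eq_zero fun i _ => if_neg ?_
      omega
  rw [h1, h2]; simp

/-- The grid functions `φ_k` are eigenvectors of the difference matrix. -/
lemma sum_diffWeight_mul_phi {N : ℕ} (k : ℕ) (j : Fin (N - 1)) :
    (N : ℝ) ^ 2 * ∑ i, diffWeight i j * phi k (node N i) = lamh N k * phi k (node N j) := by
  have hN : (N : ℝ) ≠ 0 := by exact_mod_cast (pos_of_fin j).ne'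
  have h := sum_diffWeight_mul (fun m : ℕ => phi k ((m : ℝ) / N)) (by simp [phi])
    (by rw [Nat.sub_add_cancel (pos_of_fin j), div_self hN, phi_one_right]) j
  simp only [node_eq]
  rw [h]
  simp only [lamh, phi]
  set θ := (k : ℝ) * Real.pi / N with hθ
  have e1 : (k : ℝ) * Real.pi * ((j : ℕ) / N) = k * Real.pi * (((j + 1 : ℕ) : ℝ) / N) - θ := by
    rw [hθ]; push_cast; ring
  have e2 : (k : ℝ) * Real.pi * (((j + 2 : ℕ) : ℝ) / N) =
      k * Real.pi * (((j + 1 : ℕ) : ℝ) / N) + θ := by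
    rw [hθ]; push_cast; ring
  have e3 : (k : ℝ) * Real.pi / (2 * N) = θ / 2 := by rw [hθ]; field_simp
  have e4 : Real.sin (θ / 2) ^ 2 = (1 - Real.cos θ) / 2 := by
    have := Real.cos_sq' (θ / 2)
    have h2 := Real.cos_two_mul (θ / 2)
    rw [mul_div_cancel₀ θ two_ne_zero] at h2
    linarith
  rw [e1, e2, e3, e4, Real.sin_sub, Real.sin_add]
  ring

lemma lam_pos {k : ℕ} (hk : 1 ≤ k) : 0 < lam k := by
  have : (0 : ℝ) < k := by exact_mod_cast hk
  unfold lam; positivity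

lemma lamh_lower {N k : ℕ} (hkN : k ≤ N) (hN : 1 ≤ N) : 4 * (k : ℝ) ^ 2 ≤ lamh N k := by
  have hN' : (0 : ℝ) < N := by exact_mod_cast hN
  have hkN' : (k : ℝ) ≤ N := by exact_mod_cast hkN
  have h := Real.mul_le_sin (x := k * Real.pi / (2 * N)) (by positivity)
    (by rw [div_le_div_iff₀ (by positivity) two_pos]; nlinarith [Real.pi_pos])
  have h2 : 2 / Real.pi * (k * Real.pi / (2 * N)) = k / N := by
    have := Real.pi_pos.ne'
    field_simp
  rw [h2] at h
  have h3 : (k / N : ℝ) ^ 2 ≤ Real.sin (k * Real.pi / (2 * N)) ^ 2 :=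
    pow_le_pow_left₀ (by positivity) h 2
  calc 4 * (k : ℝ) ^ 2 = 4 * (N : ℝ) ^ 2 * (k / N : ℝ) ^ 2 := by field_simp
    _ ≤ _ := mul_le_mul_of_nonneg_left h3 (by positivity)

lemma sq_sub_sin_sq_le {x : ℝ} (hx : 0 ≤ x) : x ^ 2 - Real.sin x ^ 2 ≤ x ^ 4 := by
  rcases le_total x 1 with h1 | h1
  · rcases hx.eq_or_lt with rfl | h0
    · simp
    have hs := Real.sin_gt_sub_cube h0
    have hs2 := Real.sin_le hx
    have hs0 := Real.sin_nonneg_of_nonneg_of_le_pi hx (by linarith [Real.pi_gt_three])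
    nlinarith [mul_le_mul (show x - Real.sin x ≤ x ^ 3 / 4 by linarith)
      (show x + Real.sin x ≤ 2 * x by linarith) (by linarith) (by positivity)]
  · nlinarith [sq_nonneg (Real.sin x), pow_le_pow_left₀ zero_le_one h1 2,
      sq_nonneg x]

lemma abs_lam_sub_lamh_le {N k : ℕ} (hN : 1 ≤ N) :
    |lam k - lamh N k| ≤ Real.pi ^ 4 / 4 * (k : ℝ) ^ 4 / (N : ℝ) ^ 2 := by
  have hN' : (0 : ℝ) < N := by exact_mod_cast hN
  set x := (k : ℝ) * Real.pi / (2 * N) with hx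
  have hx0 : 0 ≤ x := by positivity
  have e : lam k - lamh N k = 4 * (N : ℝ) ^ 2 * (x ^ 2 - Real.sin x ^ 2) := by
    rw [lam, lamh, ← hx, mul_sub]
    congr 1
    rw [hx]; field_simp; norm_num
  have hsin : |Real.sin x| ≤ x := (Real.abs_sin_le_abs).trans_eq (abs_of_nonneg hx0)
  have h0 : 0 ≤ x ^ 2 - Real.sin x ^ 2 := by
    nlinarith [sq_abs (Real.sin x), abs_nonneg (Real.sin x)]
  rw [e, abs_of_nonneg (by positivity)]
  calc 4 * (N : ℝ) ^ 2 * (x ^ 2 - Real.sin x ^ 2) ≤ 4 * (N : ℝ) ^ 2 * x ^ 4 :=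
        mul_le_mul_of_nonneg_left (sq_sub_sin_sq_le hx0) (by positivity)
    _ = _ := by rw [hx]; field_simp; ring

lemma phi_add_mul_node {N : ℕ} (j m : ℕ) (i : Fin (N - 1)) :
    phi (j * N + m) (node N i) = (-1) ^ (j * (i + 1)) * phi m (node N i) := by
  have hN : (N : ℝ) ≠ 0 := by exact_mod_cast (pos_of_fin i).ne'
  have e : ((j * N + m : ℕ) : ℝ) * Real.pi * (((i + 1 : ℕ) : ℝ) / N) =
      m * Real.pi * (((i + 1 : ℕ) : ℝ) / N) + (j * (i + 1) : ℕ) * Real.pi := by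
    push_cast; field_simp; ring
  rw [phi, phi, node_eq, e, Real.sin_add_nat_mul_pi]; ring

/-- Discrete Parseval identity on a block of `N` consecutive frequencies. -/
lemma sum_sq_block {N : ℕ} (hN : 1 ≤ N) (j : ℕ) (a : ℕ → ℝ) :
    ∑ i, (∑ m ∈ Finset.range N, a m * phi (j * N + m) (node N i)) ^ 2 =
      N * ∑ m ∈ Finset.Icc 1 (N - 1), a m ^ 2 := by
  have hrange : ∀ i : Fin (N - 1), ∑ m ∈ Finset.range N, a m * phi (j * N + m) (node N i) =
      (-1) ^ (j * (i + 1)) * ∑ m ∈ Finset.Icc 1 (N - 1), a m * phi m (node N i) := by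
    intro i
    have h1 : ∑ m ∈ Finset.Icc 1 (N - 1), a m * phi m (node N i) =
        ∑ m ∈ Finset.range N, a m * phi m (node N i) := by
      refine Finset.sum_subset (fun m hm => ?_) fun m hm hm' => ?_
      · rw [Finset.mem_Icc] at hm; rw [Finset.mem_range]; omega
      · rw [Finset.mem_Icc] at hm'; rw [Finset.mem_range] at hm
        rw [show m = 0 by omega]; simp [phi]
    rw [h1, Finset.mul_sum]
    refine Finset.sum_congr rfl fun m _ => ?_
    rw [phi_add_mul_node]; ring
  have hsign : ∀ i : Fin (N - 1), ((-1 : ℝ) ^ (j * ((i : ℕ) + 1))) ^ 2 = 1 := fun i => by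
    rw [← pow_mul, mul_comm, pow_mul]; simp
  simp only [hrange, mul_pow, hsign, one_mul]
  calc ∑ i, (∑ m ∈ Finset.Icc 1 (N - 1), a m * phi m (node N i)) ^ 2
      = ∑ m ∈ Finset.Icc 1 (N - 1), ∑ l ∈ Finset.Icc 1 (N - 1),
          a m * a l * ∑ i, phi m (node N i) * phi l (node N i) := by
        simp only [sq, Finset.sum_mul_sum]
        rw [Finset.sum_comm]
        refine Finset.sum_congr rfl fun m _ => ?_
        rw [Finset.sum_comm]
        refine Finset.sum_congr rfl fun l _ => ?_
        rw [Finset.mul_sum]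
        exact Finset.sum_congr rfl fun i _ => by ring
    _ = ∑ m ∈ Finset.Icc 1 (N - 1), ∑ l ∈ Finset.Icc 1 (N - 1),
          a m * a l * (if m = l then (N : ℝ) else 0) :=
        Finset.sum_congr rfl fun m hm => Finset.sum_congr rfl fun l hl => by
          rw [sum_phi_mul_phi_node hm hl]
    _ = _ := by
        rw [Finset.mul_sum]
        refine Finset.sum_congr rfl fun m hm => ?_
        simp only [mul_ite, mul_zero, Finset.sum_ite_eq, hm, if_true]
        ring

/-! ## The scalar problems for the coefficients -/

lemma intervalIntegrable_rlKernel_smul {E : Type*} [NormedAddCommGroup E] [NormedSpace ℝ E]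
    {α T x : ℝ} (hα1 : α < 1) {w : ℝ → E} (hw : ContinuousOn w (Icc 0 T)) (hx : x ∈ Icc 0 T) :
    IntervalIntegrable (fun ξ => (x - ξ) ^ (-α) • w ξ) volume 0 x := by
  refine (intervalIntegrable_sub_rpow hα1 x 0 x).smul_continuousOn (hw.mono ?_)
  rw [uIcc_of_le hx.1]; exact Icc_subset_Icc le_rfl hx.2

lemma HasRLDerivAt.clm_comp {E F : Type*} [NormedAddCommGroup E] [NormedSpace ℝ E]
    [CompleteSpace E] [NormedAddCommGroup F] [NormedSpace ℝ F] [CompleteSpace F]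
    {α T t : ℝ} (hα1 : α < 1) {w : ℝ → E} {d : E} (hw : ContinuousOn w (Icc 0 T))
    (ht : t ∈ Icc 0 T) (h : HasRLDerivAt α T w d t) (L : E →L[ℝ] F) :
    HasRLDerivAt α T (fun s => L (w s)) (L d) t := by
  have hI : ∀ x ∈ Icc 0 T, rlIntegral α (fun s => L (w s)) x = L (rlIntegral α w x) := by
    intro x hx
    simp only [rlIntegral, map_smul]
    rw [← L.intervalIntegral_comp_comm (intervalIntegrable_rlKernel_smul hα1 hw hx)]
    simp only [map_smul]
  exact (L.hasFDerivAt.comp_hasDerivWithinAt t h).congr hI (hI t ht)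

lemma HasRLDerivAt.sum_mul {ι : Type*} [Fintype ι] {α T t : ℝ} (hα1 : α < 1)
    {w : ι → ℝ → ℝ} {d : ι → ℝ} (c : ι → ℝ) (hw : ∀ i, ContinuousOn (w i) (Icc 0 T))
    (ht : t ∈ Icc 0 T) (h : ∀ i, HasRLDerivAt α T (w i) (d i) t) :
    HasRLDerivAt α T (fun s => ∑ i, c i * w i s) (∑ i, c i * d i) t := by
  have hI : ∀ x ∈ Icc 0 T, rlIntegral α (fun s => ∑ i, c i * w i s) x =
      ∑ i, c i * rlIntegral α (w i) x := by
    intro x hx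
    simp only [rlIntegral, smul_eq_mul, Finset.mul_sum]
    rw [intervalIntegral.integral_finsetSum, Finset.mul_sum]
    · refine Finset.sum_congr rfl fun i _ => ?_
      rw [mul_left_comm (c i), ← intervalIntegral.integral_const_mul (c i)]
      congr 1
      exact intervalIntegral.integral_congr fun ξ _ => mul_left_comm _ _ _
    · intro i _
      have := (intervalIntegrable_rlKernel_smul hα1 (hw i) hx).const_mul (c i)
      simpa only [smul_eq_mul, mul_left_comm] using this
  exact (HasDerivWithinAt.fun_sum fun i _ => (h i).const_mul (c i)).congr hI (hI t ht)

section Coefficients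

variable {α T : ℝ} {f ft : ℝ → L2}

lemma IsSolution.sineCoef_hasRLDerivAt (hα1 : α < 1) {u : ℝ → ℝ → ℝ}
    (hu : IsSolution α T 0 f u) (k : ℕ) :
    ContinuousOn (fun s => sineCoef (u s) k) (Icc 0 T) ∧
    (0 ≤ T → sineCoef (u 0) k = 0) ∧
    ∀ t ∈ Ioc 0 T, HasRLDerivAt α T (fun s => sineCoef (u s) k)
      (coef (f t) k - lam k * sineCoef (u t) k) t := by
  obtain ⟨U, hUu, hUc, hU0, hD⟩ := hu
  have hc : ∀ s ∈ Icc 0 T, coefL k (U s) = sineCoef (u s) k := fun s hs => by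
    rw [coefL_apply, coef_eq_sineCoef_of_ae (hUu s hs)]
  have hc' : EqOn (fun s => sineCoef (u s) k) (fun s => coefL k (U s)) (Icc 0 T) :=
    fun s hs => (hc s hs).symm
  refine ⟨((coefL k).continuous.comp_continuousOn hUc).congr hc', fun hT => ?_, fun t ht => ?_⟩
  · rw [← hc 0 ⟨le_rfl, hT⟩, hU0, map_zero]
  · obtain ⟨g, hg, hgD⟩ := hD t ht
    have ht' : t ∈ Icc 0 T := Ioc_subset_Icc_self ht
    simp only [sub_zero] at hgD
    have h := hgD.clm_comp hα1 hUc ht' (coefL k)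
    rw [map_sub, coefL_apply, coefL_apply, hg.coef_eq] at h
    have hI : ∀ x ∈ Icc 0 T, rlIntegral α (fun s => sineCoef (u s) k) x =
        rlIntegral α (fun s => coefL k (U s)) x := by
      intro x hx
      simp only [rlIntegral]
      congr 1
      refine intervalIntegral.integral_congr fun ξ hξ => ?_
      rw [uIcc_of_le hx.1] at hξ
      simp only [hc ξ ⟨hξ.1, hξ.2.trans hx.2⟩]
    exact HasDerivWithinAt.congr h hI (hI t ht')

lemma sample_projN_zero (N : ℕ) (i : Fin (N - 1)) : sample N (projN N 0) i = 0 := by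
  simp [sample, projN, coef_zero]

lemma IsModifiedSchemeSolution.dst_hasRLDerivAt (hα1 : α < 1) {N : ℕ}
    {uh : ℝ → Fin (N - 1) → ℝ} (huh : IsModifiedSchemeSolution α T N 0 f uh) {k : ℕ}
    (hk : k ∈ Finset.Icc 1 (N - 1)) :
    ContinuousOn (fun s => dst N k (uh s)) (Icc 0 T) ∧ dst N k (uh 0) = 0 ∧
    ∀ t ∈ Ioc 0 T, HasRLDerivAt α T (fun s => dst N k (uh s))
      (coef (f t) k - lamh N k * dst N k (uh t)) t := by
  have hN : (N : ℝ) ≠ 0 := by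
    rw [Finset.mem_Icc] at hk
    exact_mod_cast (by omega : N ≠ 0)
  have hdst : ∀ w, dst N k w = ∑ i, ((N : ℝ)⁻¹ * phi k (node N i)) * w i := fun w => by
    rw [dst, Finset.mul_sum]; exact Finset.sum_congr rfl fun i _ => by ring
  refine ⟨?_, ?_, fun t ht => ?_⟩
  · simp only [hdst]
    exact continuousOn_finsetSum _ fun i _ => continuousOn_const.mul (huh i).1
  · rw [hdst]
    refine Finset.sum_eq_zero fun i _ => ?_
    rw [(huh i).2.1, sample_projN_zero, mul_zero]
  · have h := HasRLDerivAt.sum_mul hα1 (fun i => (N : ℝ)⁻¹ * phi k (node N i))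
      (fun i => (huh i).1) (Ioc_subset_Icc_self ht)
      (fun i => by simpa only [sample_projN_zero, sub_zero] using (huh i).2.2 t ht)
    have hfun : (fun s => dst N k (uh s)) =
        fun s => ∑ i, ((N : ℝ)⁻¹ * phi k (node N i)) * uh s i := funext fun s => hdst _
    rw [hfun]
    convert h using 1
    simp only [mul_sub, Finset.sum_sub_distrib]
    congr 1
    · have h1 : ∀ i, (N : ℝ)⁻¹ * phi k (node N i) * sample N (projN N (f t)) i =
          ∑ l ∈ Finset.Icc 1 (N - 1), (N : ℝ)⁻¹ * coef (f t) l *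
            (phi k (node N i) * phi l (node N i)) := by
        intro i
        rw [sample, projN, Finset.mul_sum]
        exact Finset.sum_congr rfl fun l _ => by ring
      simp only [h1]
      rw [Finset.sum_comm]
      simp only [← Finset.mul_sum]
      rw [Finset.sum_congr rfl fun l hl => by rw [sum_phi_mul_phi_node hk hl]]
      simp only [mul_ite, mul_zero, Finset.sum_ite_eq, hk, if_true]
      field_simp
    · have h1 : ∀ i, (N : ℝ)⁻¹ * phi k (node N i) * ((N : ℝ) ^ 2 * ∑ j, diffWeight i j * uh t j) =
          ∑ j, (N : ℝ)⁻¹ * uh t j * ((N : ℝ) ^ 2 * (diffWeight i j * phi k (node N i))) := by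
        intro i
        rw [Finset.mul_sum, Finset.mul_sum]
        exact Finset.sum_congr rfl fun j _ => by ring
      simp only [h1]
      rw [Finset.sum_comm]
      simp only [← Finset.mul_sum, sum_diffWeight_mul_phi]
      rw [dst, Finset.mul_sum, Finset.mul_sum]
      exact Finset.sum_congr rfl fun j _ => by ring

/-- The bound `|(f(0), φ_k)| + ∫_0^t |(f_t(s), φ_k)| ds` for the `k`-th coefficient of `f`
on `[0,t]`. -/
noncomputable def coefBound (f ft : ℝ → L2) (t : ℝ) (k : ℕ) : ℝ :=
  |coef (f 0) k| + ∫ s in Ioc 0 t, |coef (ft s) k|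

lemma coefBound_nonneg (f ft : ℝ → L2) (t : ℝ) (k : ℕ) : 0 ≤ coefBound f ft t k :=
  add_nonneg (abs_nonneg _) (integral_nonneg fun _ => abs_nonneg _)

variable {t : ℝ}

lemma IsTimeDerivOn.integrable_coef (h : IsTimeDerivOn t f ft) (k : ℕ) :
    IntegrableOn (fun s => coef (ft s) k) (Ioc 0 t) := by
  have := (coefL k).integrable_comp h.1
  simp only [coefL_apply] at this
  exact this

lemma IsTimeDerivOn.coef_eq (h : IsTimeDerivOn t f ft) (k : ℕ) {s : ℝ} (hs : s ∈ Icc 0 t) :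
    coef (f s) k = coef (f 0) k + ∫ r in (0 : ℝ)..s, coef (ft r) k := by
  have hi : IntervalIntegrable ft volume 0 s := by
    rw [intervalIntegrable_iff_integrableOn_Ioc_of_le hs.1]
    exact h.1.mono_set (Ioc_subset_Ioc_right hs.2)
  have := congrArg (coefL k) (h.2 s hs)
  rw [map_add, ← (coefL k).intervalIntegral_comp_comm hi] at this
  simpa only [coefL_apply] using this

lemma IsTimeDerivOn.continuousOn_coef (h : IsTimeDerivOn t f ft) (ht : 0 ≤ t) (k : ℕ) :
    ContinuousOn (fun s => coef (f s) k) (Icc 0 t) := by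
  have hi : IntervalIntegrable (fun s => coef (ft s) k) volume 0 t := by
    rw [intervalIntegrable_iff_integrableOn_Ioc_of_le ht]; exact h.integrable_coef k
  have := intervalIntegral.continuousOn_primitive_interval' hi left_mem_uIcc
  rw [uIcc_of_le ht] at this
  exact (continuousOn_const.add this).congr fun s hs => h.coef_eq k hs

lemma IsTimeDerivOn.abs_coef_le (h : IsTimeDerivOn t f ft) (k : ℕ) {s : ℝ} (hs : s ∈ Icc 0 t) :
    |coef (f s) k| ≤ coefBound f ft t k := by
  rw [h.coef_eq k hs, coefBound]
  refine (abs_add_le _ _).trans (add_le_add_right ?_ _)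
  rw [intervalIntegral.integral_of_le hs.1]
  refine (abs_integral_le_integral_abs).trans ?_
  exact setIntegral_mono_set (h.integrable_coef k).abs
    (Eventually.of_forall fun _ => abs_nonneg _) (Ioc_subset_Ioc_right hs.2).eventuallyLE

lemma IsSolution.abs_sineCoef_le (hα0 : 0 < α) (hα1 : α < 1) {u : ℝ → ℝ → ℝ}
    (hu : IsSolution α T 0 f u) (ht : t ∈ Ioc 0 T) (hf : IsTimeDerivOn t f ft) {k : ℕ}
    (hk : 1 ≤ k) : |sineCoef (u t) k| ≤ coefBound f ft t k / lam k := by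
  obtain ⟨h1, h2, h3⟩ := hu.sineCoef_hasRLDerivAt hα1 k
  exact abs_le_of_hasRLDerivAt hα0 hα1 ht.1 (lam_pos hk) (h1.mono (Icc_subset_Icc le_rfl ht.2))
    (h2 (ht.1.le.trans ht.2)) (hf.continuousOn_coef ht.1.le k)
    (fun s hs => (h3 s ⟨hs.1, hs.2.trans ht.2⟩).mono ht.2) (fun s hs => hf.abs_coef_le k hs) t
    (right_mem_Icc.2 ht.1.le)

lemma abs_sineCoef_sub_dst_le (hα0 : 0 < α) (hα1 : α < 1) {u : ℝ → ℝ → ℝ} {N : ℕ}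
    {uh : ℝ → Fin (N - 1) → ℝ} (hu : IsSolution α T 0 f u)
    (huh : IsModifiedSchemeSolution α T N 0 f uh) (ht : t ∈ Ioc 0 T)
    (hf : IsTimeDerivOn t f ft) {k : ℕ} (hk : k ∈ Finset.Icc 1 (N - 1)) :
    |sineCoef (u t) k - dst N k (uh t)| ≤ coefBound f ft t k / (N : ℝ) ^ 2 := by
  obtain ⟨h1, h2, h3⟩ := hu.sineCoef_hasRLDerivAt hα1 k
  obtain ⟨g1, g2, g3⟩ := huh.dst_hasRLDerivAt hα1 hk
  rw [Finset.mem_Icc] at hk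
  have hkpos : (0 : ℝ) < k := by exact_mod_cast hk.1
  have hNpos : (0 : ℝ) < N := by exact_mod_cast (by omega : 0 < N)
  have hlow := lamh_lower (N := N) (k := k) (by omega) (by omega)
  have hlamh : 0 < lamh N k := lt_of_lt_of_le (by positivity) hlow
  have hlam := lam_pos hk.1
  have hsub : Icc 0 t ⊆ Icc 0 T := Icc_subset_Icc le_rfl ht.2
  have h := abs_sub_le_of_hasRLDerivAt hα0 hα1 ht.1 hlam hlamh (h1.mono hsub) (g1.mono hsub)
    (h2 (ht.1.le.trans ht.2)) g2 (hf.continuousOn_coef ht.1.le k)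
    (fun s hs => (h3 s ⟨hs.1, hs.2.trans ht.2⟩).mono ht.2)
    (fun s hs => (g3 s ⟨hs.1, hs.2.trans ht.2⟩).mono ht.2) (fun s hs => hf.abs_coef_le k hs)
  refine h.trans ?_
  rw [div_eq_inv_mul (coefBound f ft t k)]
  refine mul_le_mul_of_nonneg_right ?_ (coefBound_nonneg _ _ _ _)
  calc |lam k - lamh N k| / (lam k * lamh N k)
      ≤ (Real.pi ^ 4 / 4 * (k : ℝ) ^ 4 / (N : ℝ) ^ 2) / (lam k * (4 * (k : ℝ) ^ 2)) :=
        div_le_div₀ (by positivity) (abs_lam_sub_lamh_le (by omega)) (by positivity)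
          (mul_le_mul_of_nonneg_left hlow hlam.le)
    _ = Real.pi ^ 2 / 16 * ((N : ℝ) ^ 2)⁻¹ := by
        rw [lam]
        have := Real.pi_pos
        field_simp
        norm_num
    _ ≤ 1 * ((N : ℝ) ^ 2)⁻¹ := by
        refine mul_le_mul_of_nonneg_right ?_ (by positivity)
        nlinarith [Real.pi_pos, Real.pi_le_four]
    _ = _ := one_mul _

end Coefficients

/-! ## Weighted `ℓ²` bounds -/

lemma sum_mul_abs_coef_le (σ : ℝ) (F : ℕ → ℝ) {s : Finset ℕ} (hs : ∀ k ∈ s, 0 < k) (v : L2) :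
    ENNReal.ofReal (∑ k ∈ s, lam k ^ σ * F k * |coef v k|) ≤
      ENNReal.ofReal √(∑ k ∈ s, lam k ^ σ * F k ^ 2) * hatNorm σ v := by
  have hw : ∀ k, 0 ≤ lam k ^ σ := fun k => Real.rpow_nonneg (by unfold lam; positivity) _
  have hsq : ∀ k, √(lam k ^ σ) * √(lam k ^ σ) = lam k ^ σ := fun k => Real.mul_self_sqrt (hw k)
  have h1 := Real.sum_mul_le_sqrt_mul_sqrt s (fun k => √(lam k ^ σ) * F k)
    (fun k => √(lam k ^ σ) * |coef v k|)
  have e1 : ∀ k, √(lam k ^ σ) * F k * (√(lam k ^ σ) * |coef v k|) =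
      lam k ^ σ * F k * |coef v k| := fun k => by linear_combination F k * |coef v k| * hsq k
  simp only [e1, mul_pow, Real.sq_sqrt (hw _), sq_abs] at h1
  refine (ENNReal.ofReal_le_ofReal h1).trans ?_
  rw [ENNReal.ofReal_mul (Real.sqrt_nonneg _)]
  refine mul_le_mul_right ?_ _
  rw [Real.sqrt_eq_rpow, hatNorm, ← ENNReal.ofReal_rpow_of_nonneg
    (Finset.sum_nonneg fun k _ => mul_nonneg (hw k) (sq_nonneg _)) (by norm_num)]
  refine ENNReal.rpow_le_rpow ?_ (by norm_num)
  rw [ENNReal.ofReal_sum_of_nonneg fun k _ => mul_nonneg (hw k) (sq_nonneg _),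
    ← Finset.sum_subtype_of_mem (p := fun k => 0 < k) _ hs]
  exact ENNReal.sum_le_tsum (f := fun k : ℕ+ => ENNReal.ofReal (lam k ^ σ * coef v k ^ 2)) _

/-- Minkowski's inequality for the weighted `ℓ²` norm of `coefBound`. -/
lemma sum_lam_rpow_mul_coefBound_sq_le (σ : ℝ) {f ft : ℝ → L2} {t : ℝ}
    (hf : IsTimeDerivOn t f ft) (h0 : hatNorm σ (f 0) < ∞)
    (h1 : ∫⁻ s in Ioc 0 t, hatNorm σ (ft s) < ∞) {s : Finset ℕ} (hs : ∀ k ∈ s, 0 < k) :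
    √(∑ k ∈ s, lam k ^ σ * coefBound f ft t k ^ 2) ≤
      (hatNorm σ (f 0)).toReal + (∫⁻ s in Ioc 0 t, hatNorm σ (ft s)).toReal := by
  set F := coefBound f ft t with hF
  have hw : ∀ k, 0 ≤ lam k ^ σ := fun k => Real.rpow_nonneg (by unfold lam; positivity) _
  have hFnn : ∀ k, 0 ≤ F k := coefBound_nonneg f ft t
  have hSnn : 0 ≤ ∑ k ∈ s, lam k ^ σ * F k ^ 2 :=
    Finset.sum_nonneg fun k _ => mul_nonneg (hw k) (sq_nonneg _)
  set A := √(∑ k ∈ s, lam k ^ σ * F k ^ 2) with hA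
  have hA0 : 0 ≤ A := Real.sqrt_nonneg _
  have hpt : ∀ v : L2, 0 ≤ ∑ k ∈ s, lam k ^ σ * F k * |coef v k| := fun v =>
    Finset.sum_nonneg fun k _ => mul_nonneg (mul_nonneg (hw k) (hFnn k)) (abs_nonneg _)
  have hsplit : A * A = (∑ k ∈ s, lam k ^ σ * F k * |coef (f 0) k|) +
      ∫ r in Ioc 0 t, ∑ k ∈ s, lam k ^ σ * F k * |coef (ft r) k| := by
    rw [integral_finsetSum _ fun k _ => ((hf.integrable_coef k).abs.const_mul _),
      ← Finset.sum_add_distrib, Real.mul_self_sqrt hSnn]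
    refine Finset.sum_congr rfl fun k _ => ?_
    rw [integral_const_mul, ← mul_add, sq, ← mul_assoc]
    rfl
  have hb0 : ∑ k ∈ s, lam k ^ σ * F k * |coef (f 0) k| ≤ A * (hatNorm σ (f 0)).toReal := by
    have h := ENNReal.toReal_mono (ENNReal.mul_ne_top ENNReal.ofReal_ne_top h0.ne)
      (sum_mul_abs_coef_le σ F hs (f 0))
    rwa [ENNReal.toReal_ofReal (hpt _), ENNReal.toReal_mul, ENNReal.toReal_ofReal hA0] at h
  have hb1 : ∫ r in Ioc 0 t, ∑ k ∈ s, lam k ^ σ * F k * |coef (ft r) k| ≤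
      A * (∫⁻ s in Ioc 0 t, hatNorm σ (ft s)).toReal := by
    have hint : IntegrableOn (fun r => ∑ k ∈ s, lam k ^ σ * F k * |coef (ft r) k|) (Ioc 0 t) :=
      integrable_finsetSum _ fun k _ => ((hf.integrable_coef k).abs.const_mul _)
    rw [integral_eq_lintegral_of_nonneg_ae (Eventually.of_forall fun r => hpt (ft r))
      hint.aestronglyMeasurable]
    have h : ∫⁻ r in Ioc 0 t, ENNReal.ofReal (∑ k ∈ s, lam k ^ σ * F k * |coef (ft r) k|) ≤
        ENNReal.ofReal A * ∫⁻ s in Ioc 0 t, hatNorm σ (ft s) := by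
      rw [← lintegral_const_mul' _ _ ENNReal.ofReal_ne_top]
      exact lintegral_mono fun r => sum_mul_abs_coef_le σ F hs (ft r)
    have h2 := ENNReal.toReal_mono (ENNReal.mul_ne_top ENNReal.ofReal_ne_top h1.ne) h
    rwa [ENNReal.toReal_mul, ENNReal.toReal_ofReal hA0] at h2
  rcases hA0.eq_or_lt with h | h
  · rw [← h]; positivity
  · refine le_of_mul_le_mul_left ?_ h
    rw [hsplit, mul_add]; exact add_le_add hb0 hb1

/-! ## Power sums -/

lemma sum_rpow_sub_one_le {p : ℝ} (hp0 : 0 < p) (hp1 : p ≤ 1) (n : ℕ) :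
    ∑ k ∈ Finset.Icc 1 n, (k : ℝ) ^ (p - 1) ≤ (n : ℝ) ^ p / p := by
  induction n with
  | zero => simp [Real.zero_rpow hp0.ne']
  | succ n ih =>
    rw [Finset.sum_Icc_succ_top (by omega)]
    have hn : (0 : ℝ) < ((n + 1 : ℕ) : ℝ) := by positivity
    have hb := rpow_one_add_le_one_add_mul_self (s := -(1 / ((n + 1 : ℕ) : ℝ)))
      (by rw [neg_le_neg_iff, div_le_one hn]; push_cast; linarith [Nat.cast_nonneg (α := ℝ) n])
      hp0.le hp1
    have e : 1 + -(1 / ((n + 1 : ℕ) : ℝ)) = n / ((n + 1 : ℕ) : ℝ) := by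
      field_simp; push_cast; ring
    rw [e, Real.div_rpow (Nat.cast_nonneg n) hn.le, div_le_iff₀ (by positivity)] at hb
    rw [Real.rpow_sub_one hn.ne']
    have h2 : (1 + p * -(1 / ((n + 1 : ℕ) : ℝ))) * ((n + 1 : ℕ) : ℝ) ^ p =
        ((n + 1 : ℕ) : ℝ) ^ p - p * (((n + 1 : ℕ) : ℝ) ^ p / ((n + 1 : ℕ) : ℝ)) := by
      field_simp; ring
    rw [h2] at hb
    calc _ ≤ (n : ℝ) ^ p / p + ((n + 1 : ℕ) : ℝ) ^ p / ((n + 1 : ℕ) : ℝ) := by gcongr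
      _ = ((n : ℝ) ^ p + p * (((n + 1 : ℕ) : ℝ) ^ p / ((n + 1 : ℕ) : ℝ))) / p := by field_simp
      _ ≤ _ := by gcongr; linarith

lemma chi0_eq_one_or_zero (x : ℝ) : chi0 x = 1 ∨ chi0 x = 0 := by
  unfold chi0; split_ifs <;> simp

lemma ell_eq {N : ℕ} (hN : 1 ≤ N) : ell (1 / (N : ℝ)) = √(Real.log N) := by
  have : 0 ≤ Real.log N := Real.log_nonneg (by exact_mod_cast hN)
  rw [ell, one_div, Real.log_inv, abs_neg, abs_of_nonneg this, Real.sqrt_eq_rpow]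

lemma le_ell_rpow_chi0 {N : ℕ} (hN : 2 ≤ N) (x : ℝ) :
    √(Real.log 2) ≤ ell (1 / (N : ℝ)) ^ chi0 x := by
  have h2 : √(Real.log 2) ≤ ell (1 / (N : ℝ)) := by
    rw [ell_eq (by omega)]
    exact Real.sqrt_le_sqrt (Real.log_le_log two_pos (by exact_mod_cast hN))
  rcases chi0_eq_one_or_zero x with h | h <;> rw [h]
  · rwa [Real.rpow_one]
  · rw [Real.rpow_zero, Real.sqrt_le_one]
    linarith [Real.log_two_lt_d9]

/-- The rate of the truncated sum `∑_{k<N} k^{-2σ}`. -/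
lemma exists_sqrt_sum_rpow_le {σ : ℝ} (hσ : 0 ≤ σ) :
    ∃ C : ℝ, 0 < C ∧ ∀ N : ℕ, 2 ≤ N →
      1 / (N : ℝ) ^ 2 * √(∑ k ∈ Finset.Icc 1 (N - 1), (k : ℝ) ^ (-(2 * σ))) ≤
        C * (1 / (N : ℝ)) ^ min (σ + 3 / 2) 2 * ell (1 / (N : ℝ)) ^ chi0 (1 / 4 - σ / 2) := by
  have hl2 : 0 < Real.log 2 := Real.log_pos one_lt_two
  rcases lt_trichotomy σ (1 / 2) with h | h | h
  · refine ⟨√(1 / (1 - 2 * σ)), Real.sqrt_pos.2 (by have : 0 < 1 - 2 * σ := by linarith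
                                                    positivity), fun N hN => ?_⟩
    have hp : 0 < 1 - 2 * σ := by linarith
    have hN' : (0 : ℝ) < N := by exact_mod_cast (by omega : 0 < N)
    have hchi : chi0 (1 / 4 - σ / 2) = 0 := if_neg (by linarith)
    have hs := sum_rpow_sub_one_le hp (by linarith) (N - 1)
    rw [show (1 - 2 * σ) - 1 = -(2 * σ) by ring] at hs
    have hs2 : ((N - 1 : ℕ) : ℝ) ^ (1 - 2 * σ) / (1 - 2 * σ) ≤
        1 / (1 - 2 * σ) * ((N : ℝ) ^ (1 / 2 - σ)) ^ 2 := by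
      rw [← Real.rpow_natCast, ← Real.rpow_mul hN'.le, div_eq_inv_mul, ← one_div,
        show (1 / 2 - σ) * ((2 : ℕ) : ℝ) = 1 - 2 * σ by push_cast; ring]
      gcongr
      exact_mod_cast Nat.sub_le N 1
    rw [hchi, Real.rpow_zero, mul_one, min_eq_left (by linarith)]
    calc _ ≤ 1 / (N : ℝ) ^ 2 * √(1 / (1 - 2 * σ) * ((N : ℝ) ^ (1 / 2 - σ)) ^ 2) := by
          gcongr; exact hs.trans hs2
      _ = √(1 / (1 - 2 * σ)) * ((N : ℝ) ^ (1 / 2 - σ) / (N : ℝ) ^ 2) := by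
          rw [Real.sqrt_mul (by positivity), Real.sqrt_sq (by positivity)]; ring
      _ = _ := by
          congr 1
          rw [← Real.rpow_natCast, ← Real.rpow_sub hN', one_div (N : ℝ), Real.inv_rpow hN'.le,
            ← Real.rpow_neg hN'.le]
          congr 1; push_cast; ring
  · refine ⟨√(1 / Real.log 2 + 1), by positivity, fun N hN => ?_⟩
    have hN' : (0 : ℝ) < N := by exact_mod_cast (by omega : 0 < N)
    have hchi : chi0 (1 / 4 - σ / 2) = 1 := if_pos (by rw [h]; norm_num)
    have hlog : Real.log 2 ≤ Real.log N := Real.log_le_log two_pos (by exact_mod_cast hN)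
    have hs : ∑ k ∈ Finset.Icc 1 (N - 1), (k : ℝ) ^ (-(2 * σ)) ≤ 1 + Real.log N := by
      have h1 := harmonic_le_one_add_log (N - 1)
      have h2 : (harmonic (N - 1) : ℝ) = ∑ k ∈ Finset.Icc 1 (N - 1), (k : ℝ) ^ (-(2 * σ)) := by
        rw [harmonic_eq_sum_Icc, h]
        push_cast
        refine Finset.sum_congr rfl fun k _ => ?_
        rw [show (-(2 * (1 / 2)) : ℝ) = -1 by norm_num, Real.rpow_neg_one]
      rw [← h2]
      refine h1.trans (add_le_add_right (Real.log_le_log ?_ ?_) _)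
      · exact_mod_cast (by omega : 0 < N - 1)
      · exact_mod_cast Nat.sub_le N 1
    rw [hchi, Real.rpow_one, ell_eq (by omega), min_eq_right (by linarith)]
    calc _ ≤ 1 / (N : ℝ) ^ 2 * √((1 / Real.log 2 + 1) * Real.log N) := by
          gcongr
          refine hs.trans ?_
          have : 1 ≤ 1 / Real.log 2 * Real.log N := by
            rw [div_mul_eq_mul_div, one_mul, one_le_div hl2]; exact hlog
          linarith
      _ = _ := by
          rw [Real.sqrt_mul (by positivity), Real.rpow_two, div_pow, one_pow]; ring
  · have hsum : Summable fun k : ℕ => (k : ℝ) ^ (-(2 * σ)) :=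
      Real.summable_nat_rpow.2 (by linarith)
    have hnn : ∀ k : ℕ, 0 ≤ (k : ℝ) ^ (-(2 * σ)) := fun k => by positivity
    have hts : 0 ≤ ∑' k : ℕ, (k : ℝ) ^ (-(2 * σ)) := tsum_nonneg hnn
    refine ⟨√(1 + ∑' k : ℕ, (k : ℝ) ^ (-(2 * σ))), by positivity, fun N hN => ?_⟩
    have hchi : chi0 (1 / 4 - σ / 2) = 0 := if_neg (by linarith)
    rw [hchi, Real.rpow_zero, mul_one, min_eq_right (by linarith), Real.rpow_two, div_pow, one_pow,
      mul_comm]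
    gcongr
    linarith [hsum.sum_le_tsum (Finset.Icc 1 (N - 1)) fun k _ => hnn k]

/-! ## Discrete norms of sine series -/

section SineSeries

variable {N : ℕ} {σ R : ℝ} {c F : ℕ → ℝ} {err : Fin (N - 1) → ℝ}

lemma sq_le_lam {k : ℕ} : (k : ℝ) ^ 2 ≤ lam k := by
  rw [lam]
  exact le_mul_of_one_le_right (by positivity) (by nlinarith [Real.pi_gt_three])

lemma one_le_lam {k : ℕ} (hk : 0 < k) : 1 ≤ lam k :=
  le_trans (one_le_pow₀ (by exact_mod_cast hk)) sq_le_lam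

lemma sum_abs_mul_le {s : Finset ℕ} (hs : ∀ k ∈ s, 0 < k)
    (hR : √(∑ k ∈ s, lam k ^ σ * F k ^ 2) ≤ R) (hσ : 0 ≤ σ) (a : ℕ → ℝ) :
    ∑ k ∈ s, a k * F k ≤ √(∑ k ∈ s, a k ^ 2 * (k : ℝ) ^ (-(2 * σ))) * R := by
  have hl : ∀ k ∈ s, 0 < lam k := fun k hk => lam_pos (hs k hk)
  have h1 := Real.sum_mul_le_sqrt_mul_sqrt s (fun k => a k * √(lam k ^ (-σ)))
    (fun k => √(lam k ^ σ) * F k)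
  have e1 : ∀ k ∈ s, a k * √(lam k ^ (-σ)) * (√(lam k ^ σ) * F k) = a k * F k := by
    intro k hk
    have : √(lam k ^ (-σ)) * √(lam k ^ σ) = 1 := by
      rw [← Real.sqrt_mul (Real.rpow_nonneg (hl k hk).le _), ← Real.rpow_add (hl k hk)]; simp
    linear_combination a k * F k * this
  rw [Finset.sum_congr rfl e1] at h1
  have e2 : ∑ k ∈ s, (√(lam k ^ σ) * F k) ^ 2 = ∑ k ∈ s, lam k ^ σ * F k ^ 2 :=
    Finset.sum_congr rfl fun k hk => by
      rw [mul_pow, Real.sq_sqrt (Real.rpow_nonneg (hl k hk).le _)]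
  rw [e2] at h1
  refine h1.trans (mul_le_mul (Real.sqrt_le_sqrt (Finset.sum_le_sum fun k hk => ?_)) hR
    (Real.sqrt_nonneg _) (Real.sqrt_nonneg _))
  have hk0 : (0 : ℝ) < k := by exact_mod_cast hs k hk
  rw [mul_pow, Real.sq_sqrt (Real.rpow_nonneg (hl k hk).le _), ← mul_neg,
    Real.rpow_mul hk0.le, Real.rpow_two]
  exact mul_le_mul_of_nonneg_left
    (Real.rpow_le_rpow_of_nonpos (by positivity) sq_le_lam (by linarith)) (sq_nonneg _)

lemma sum_Ico_pow_four_mul_rpow_le (hN : 2 ≤ N) (hσ : 0 ≤ σ) (n : ℕ) :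
    √(∑ k ∈ Finset.Ico N n, (1 / (k : ℝ) ^ 2) ^ 2 * (k : ℝ) ^ (-(2 * σ))) ≤
      √2 * (1 / (N : ℝ)) ^ (σ + 3 / 2) := by
  have hN' : (0 : ℝ) < N := by exact_mod_cast (by omega : 0 < N)
  have h1 : ∑ k ∈ Finset.Ico N n, ((k : ℝ) ^ 2)⁻¹ ≤ 2 / N := by
    have h := sum_Ioo_inv_sq_le (α := ℝ) (N - 1) n
    have e : ((N - 1 : ℕ) : ℝ) + 1 = N := by exact_mod_cast Nat.sub_add_cancel (by omega : 1 ≤ N)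
    rw [e] at h
    have e2 : Finset.Ico N n = Finset.Ioo (N - 1) n := by
      ext k; simp only [Finset.mem_Ico, Finset.mem_Ioo]; omega
    rwa [e2]
  have h2 : ∑ k ∈ Finset.Ico N n, (1 / (k : ℝ) ^ 2) ^ 2 * (k : ℝ) ^ (-(2 * σ)) ≤
      2 * ((1 / (N : ℝ)) ^ (σ + 3 / 2)) ^ 2 := by
    calc _ ≤ ∑ k ∈ Finset.Ico N n, ((N : ℝ) ^ 2)⁻¹ * (N : ℝ) ^ (-(2 * σ)) * ((k : ℝ) ^ 2)⁻¹ := by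
          refine Finset.sum_le_sum fun k hk => ?_
          have hNk : (N : ℝ) ≤ k := by exact_mod_cast (Finset.mem_Ico.1 hk).1
          have e : (1 / (k : ℝ) ^ 2) ^ 2 * (k : ℝ) ^ (-(2 * σ)) =
              ((k : ℝ) ^ 2)⁻¹ * (k : ℝ) ^ (-(2 * σ)) * ((k : ℝ) ^ 2)⁻¹ := by ring
          rw [e]
          have := Real.rpow_le_rpow_of_nonpos hN' hNk (z := -(2 * σ)) (by linarith)
          gcongr
      _ ≤ ((N : ℝ) ^ 2)⁻¹ * (N : ℝ) ^ (-(2 * σ)) * (2 / N) := by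
          rw [← Finset.mul_sum]; gcongr
      _ = _ := by
          rw [one_div, Real.inv_rpow hN'.le, ← Real.rpow_neg hN'.le, ← Real.rpow_natCast,
            ← Real.rpow_natCast, ← Real.rpow_mul hN'.le, ← Real.rpow_neg hN'.le, div_eq_mul_inv,
            ← Real.rpow_neg_one, ← Real.rpow_add hN', mul_left_comm, ← Real.rpow_add hN']
          congr 2; push_cast; ring
  refine (Real.sqrt_le_sqrt h2).trans_eq ?_
  rw [Real.sqrt_mul (by norm_num), Real.sqrt_sq (by positivity)]

lemma abs_le_of_hasSum_sineSeries (hN : 2 ≤ N) (hσ : 0 ≤ σ)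
    (hR : ∀ s : Finset ℕ, (∀ k ∈ s, 0 < k) → √(∑ k ∈ s, lam k ^ σ * F k ^ 2) ≤ R)
    (h1 : ∀ k ∈ Finset.Icc 1 (N - 1), |c k| ≤ F k / (N : ℝ) ^ 2)
    (h2 : ∀ k, N ≤ k → |c k| ≤ F k / (k : ℝ) ^ 2) {x y : ℝ}
    (hy : HasSum (fun k => c k * phi k x) y) :
    |y| ≤ √2 * (1 / (N : ℝ) ^ 2 * √(∑ k ∈ Finset.Icc 1 (N - 1), (k : ℝ) ^ (-(2 * σ))) * R +
      √2 * (1 / (N : ℝ)) ^ (σ + 3 / 2) * R) := by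
  have hR0 : 0 ≤ R := by simpa using hR ∅ (by simp)
  have hN' : (0 : ℝ) < N := by exact_mod_cast (by omega : 0 < N)
  refine le_of_tendsto hy.tendsto_sum_nat.abs ?_
  filter_upwards [eventually_ge_atTop N] with n hn
  have hbound : ∀ k, |c k * phi k x| ≤ √2 * |c k| := fun k => by
    rw [abs_mul, mul_comm]
    exact mul_le_mul_of_nonneg_right (abs_phi_le k x) (abs_nonneg _)
  have h0 : ∑ k ∈ Finset.range n, c k * phi k x = ∑ k ∈ Finset.Icc 1 (N - 1), c k * phi k x +
      ∑ k ∈ Finset.Ico N n, c k * phi k x := by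
    rw [Finset.range_eq_Ico, ← Finset.sum_Ico_consecutive _ (Nat.zero_le N) hn,
      Finset.sum_eq_sum_Ico_succ_bot (by omega)]
    have : Finset.Ico (0 + 1) N = Finset.Icc 1 (N - 1) := by
      ext k; simp only [Finset.mem_Ico, Finset.mem_Icc]; omega
    rw [this]; simp [phi]
  have hA : ∑ k ∈ Finset.Icc 1 (N - 1), |c k| ≤
      1 / (N : ℝ) ^ 2 * √(∑ k ∈ Finset.Icc 1 (N - 1), (k : ℝ) ^ (-(2 * σ))) * R := by
    have hs : ∀ k ∈ Finset.Icc 1 (N - 1), 0 < k := fun k hk => (Finset.mem_Icc.1 hk).1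
    have h := sum_abs_mul_le hs (hR _ hs) hσ (fun _ => 1)
    simp only [one_mul, one_pow] at h
    calc _ ≤ ∑ k ∈ Finset.Icc 1 (N - 1), F k / (N : ℝ) ^ 2 := Finset.sum_le_sum h1
      _ = 1 / (N : ℝ) ^ 2 * ∑ k ∈ Finset.Icc 1 (N - 1), F k := by
          rw [← Finset.sum_div]; ring
      _ ≤ _ := by rw [mul_assoc]; gcongr
  have hB : ∑ k ∈ Finset.Ico N n, |c k| ≤ √2 * (1 / (N : ℝ)) ^ (σ + 3 / 2) * R := by
    have hs : ∀ k ∈ Finset.Ico N n, 0 < k := fun k hk => by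
      have := (Finset.mem_Ico.1 hk).1; omega
    have h := sum_abs_mul_le hs (hR _ hs) hσ (fun k => 1 / (k : ℝ) ^ 2)
    calc _ ≤ ∑ k ∈ Finset.Ico N n, 1 / (k : ℝ) ^ 2 * F k := by
          refine Finset.sum_le_sum fun k hk => (h2 k (Finset.mem_Ico.1 hk).1).trans_eq ?_
          ring
      _ ≤ _ := h.trans (mul_le_mul_of_nonneg_right (sum_Ico_pow_four_mul_rpow_le hN hσ n) hR0)
  calc |∑ k ∈ Finset.range n, c k * phi k x|
      ≤ √2 * ∑ k ∈ Finset.Icc 1 (N - 1), |c k| + √2 * ∑ k ∈ Finset.Ico N n, |c k| := by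
        rw [h0, Finset.mul_sum, Finset.mul_sum]
        refine (abs_add_le _ _).trans (add_le_add ?_ ?_) <;>
        exact (Finset.abs_sum_le_sum_abs _ _).trans (Finset.sum_le_sum fun k _ => hbound k)
    _ ≤ _ := by rw [← mul_add]; gcongr

lemma sum_range_mul_eq_sum_blocks (g : ℕ → ℝ) (J N : ℕ) :
    ∑ k ∈ Finset.range (J * N), g k =
      ∑ j ∈ Finset.range J, ∑ m ∈ Finset.range N, g (j * N + m) := by
  induction J with
  | zero => simp
  | succ J ih => rw [Nat.succ_mul, Finset.sum_range_add, ih, Finset.sum_range_succ]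

lemma sqrt_sum_sq_sum_le {ι κ : Type*} [Fintype ι] (s : Finset κ) (B : κ → ι → ℝ) :
    √(∑ i, (∑ j ∈ s, B j i) ^ 2) ≤ ∑ j ∈ s, √(∑ i, B j i ^ 2) := by
  have h := norm_sum_le s fun j => (WithLp.toLp 2 (B j) : EuclideanSpace ℝ ι)
  simpa [EuclideanSpace.norm_eq] using h

lemma l2Norm_le_of_hasSum_sineSeries (hN : 2 ≤ N) (hσ : 0 ≤ σ)
    (hR : ∀ s : Finset ℕ, (∀ k ∈ s, 0 < k) → √(∑ k ∈ s, lam k ^ σ * F k ^ 2) ≤ R)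
    (h1 : ∀ k ∈ Finset.Icc 1 (N - 1), |c k| ≤ F k / (N : ℝ) ^ 2)
    (h2 : ∀ k, N ≤ k → |c k| ≤ F k / (k : ℝ) ^ 2)
    (herr : ∀ i, HasSum (fun k => c k * phi k (node N i)) (err i)) :
    l2Norm err ≤ √2 * (1 + ∑' j : ℕ, 1 / (j : ℝ) ^ 2) * (1 / (N : ℝ)) ^ 2 * R := by
  have hR0 : 0 ≤ R := by simpa using hR ∅ (by simp)
  have hN' : (0 : ℝ) < N := by exact_mod_cast (by omega : 0 < N)
  set Z : ℝ := ∑' j : ℕ, 1 / (j : ℝ) ^ 2 with hZ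
  have hZsum : Summable fun j : ℕ => 1 / (j : ℝ) ^ 2 := Real.summable_one_div_nat_pow.2 one_lt_two
  have hZ0 : 0 ≤ Z := tsum_nonneg fun j => by positivity
  set b : ℕ → ℝ := fun j => ((if j = 0 then 1 else 0) + 1 / (j : ℝ) ^ 2) * (1 / (N : ℝ) ^ 2) with hb
  have hb0 : ∀ j, 0 ≤ b j := fun j => by
    simp only [hb]; split_ifs <;> positivity
  have hcb : ∀ j, ∀ m ∈ Finset.Icc 1 (N - 1), |c (j * N + m)| ≤ b j * F (j * N + m) := by
    intro j m hm
    rcases Nat.eq_zero_or_pos j with rfl | hj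
    · refine (h1 _ (by simpa using hm)).trans_eq ?_
      simp [hb]; ring
    · have hjN : N ≤ j * N + m := by nlinarith
      have hj' : (0 : ℝ) < j := by exact_mod_cast hj
      have hF : 0 ≤ F (j * N + m) := by
        have := (abs_nonneg _).trans (h2 _ hjN)
        have hpos : (0 : ℝ) < ((j * N + m : ℕ) : ℝ) ^ 2 := by
          have : (0 : ℝ) < ((j * N + m : ℕ) : ℝ) := by exact_mod_cast (by omega)
          positivity
        exact (div_nonneg_iff.1 this).elim (fun h => h.1) fun h => absurd h.2 (not_le.2 hpos)
      refine (h2 _ hjN).trans ?_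
      rw [div_eq_inv_mul]
      refine mul_le_mul_of_nonneg_right ?_ hF
      simp only [hb, hj.ne', if_false, zero_add]
      rw [one_div_mul_one_div, ← mul_pow, ← one_div]
      refine one_div_le_one_div_of_le (by positivity) (pow_le_pow_left₀ (by positivity) ?_ 2)
      push_cast; linarith [Nat.cast_nonneg (α := ℝ) m]
  have hFblock : ∀ j, ∑ m ∈ Finset.Icc 1 (N - 1), F (j * N + m) ^ 2 ≤ R ^ 2 := by
    intro j
    have hpos : ∀ k ∈ (Finset.Icc 1 (N - 1)).map (addLeftEmbedding (j * N)), 0 < k := by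
      intro k hk
      obtain ⟨m, hm, rfl⟩ := Finset.mem_map.1 hk
      have := (Finset.mem_Icc.1 hm).1
      simp only [addLeftEmbedding_apply]; omega
    have h := hR _ hpos
    rw [Real.sqrt_le_iff] at h
    refine le_trans ?_ h.2
    rw [Finset.sum_map]
    refine Finset.sum_le_sum fun m hm => ?_
    have hl := one_le_lam (hpos _ (Finset.mem_map_of_mem _ hm))
    exact le_mul_of_one_le_left (sq_nonneg _) (Real.one_le_rpow hl hσ)
  set B : ℕ → Fin (N - 1) → ℝ := fun j i =>
    ∑ m ∈ Finset.range N, c (j * N + m) * phi (j * N + m) (node N i) with hB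
  have hBj : ∀ j, √(∑ i, B j i ^ 2) ≤ √N * (b j * R) := by
    intro j
    rw [Real.sqrt_le_left (by have := hb0 j; positivity)]
    simp only [hB]
    rw [sum_sq_block (by omega) j fun m => c (j * N + m), mul_pow, Real.sq_sqrt hN'.le]
    refine mul_le_mul_of_nonneg_left ?_ hN'.le
    calc _ ≤ ∑ m ∈ Finset.Icc 1 (N - 1), b j ^ 2 * F (j * N + m) ^ 2 := by
          refine Finset.sum_le_sum fun m hm => ?_
          rw [← sq_abs, ← mul_pow]
          exact pow_le_pow_left₀ (abs_nonneg _) (hcb j m hm) 2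
      _ ≤ _ := by
          rw [← Finset.mul_sum, mul_pow (b j)]
          exact mul_le_mul_of_nonneg_left (hFblock j) (sq_nonneg _)
  have hbsum : ∀ J, ∑ j ∈ Finset.range J, b j ≤ (1 + Z) * (1 / (N : ℝ) ^ 2) := by
    intro J
    simp only [hb]
    rw [← Finset.sum_mul, Finset.sum_add_distrib]
    refine mul_le_mul_of_nonneg_right (add_le_add ?_
      (hZsum.sum_le_tsum _ fun j _ => by positivity)) (by positivity)
    rw [Finset.sum_ite_eq']
    split_ifs <;> norm_num
  have hpart : ∀ J, √(∑ i, (∑ k ∈ Finset.range (J * N), c k * phi k (node N i)) ^ 2) ≤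
      √N * ((1 + Z) * (1 / (N : ℝ) ^ 2) * R) := by
    intro J
    simp only [sum_range_mul_eq_sum_blocks]
    calc _ ≤ ∑ j ∈ Finset.range J, √(∑ i, B j i ^ 2) := sqrt_sum_sq_sum_le _ B
      _ ≤ ∑ j ∈ Finset.range J, √N * (b j * R) := Finset.sum_le_sum fun j _ => hBj j
      _ = √N * ((∑ j ∈ Finset.range J, b j) * R) := by rw [← Finset.mul_sum, Finset.sum_mul]
      _ ≤ _ := by gcongr; exact hbsum J
  have hlim : √(∑ i, err i ^ 2) ≤ √N * ((1 + Z) * (1 / (N : ℝ) ^ 2) * R) := by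
    have hJ : Tendsto (fun J : ℕ => J * N) atTop atTop :=
      tendsto_id.atTop_mul_const' (by omega)
    have ht : Tendsto (fun J : ℕ =>
        √(∑ i, (∑ k ∈ Finset.range (J * N), c k * phi k (node N i)) ^ 2)) atTop
        (𝓝 √(∑ i, err i ^ 2)) :=
      (tendsto_finsetSum _ fun i _ => (((herr i).tendsto_sum_nat.comp hJ).pow 2)).sqrt
    exact le_of_tendsto' ht hpart
  have hM : 1 / ((N - 1 : ℕ) : ℝ) * N ≤ 2 := by
    have hN1 : (0 : ℝ) < ((N - 1 : ℕ) : ℝ) := by exact_mod_cast (by omega : 0 < N - 1)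
    rw [div_mul_eq_mul_div, one_mul, div_le_iff₀ hN1]
    exact_mod_cast (by omega : N ≤ 2 * (N - 1))
  calc l2Norm err = √(1 / ((N - 1 : ℕ) : ℝ)) * √(∑ i, err i ^ 2) := by
        rw [l2Norm, Real.sqrt_mul (by positivity)]
    _ ≤ √(1 / ((N - 1 : ℕ) : ℝ)) * (√N * ((1 + Z) * (1 / (N : ℝ) ^ 2) * R)) := by gcongr
    _ = √(1 / ((N - 1 : ℕ) : ℝ) * N) * ((1 + Z) * (1 / (N : ℝ) ^ 2) * R) := by
        rw [Real.sqrt_mul (by positivity)]; ring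
    _ ≤ √2 * ((1 + Z) * (1 / (N : ℝ) ^ 2) * R) := by gcongr
    _ = _ := by rw [div_pow, one_pow]; ring

end SineSeries

/-- The sine series of the nodal error. -/
lemma IsSolution.hasSum_error {α T t σ R : ℝ} (hα0 : 0 < α) (hα1 : α < 1) (hσ : 0 ≤ σ) {N : ℕ}
    {f ft : ℝ → L2} {u : ℝ → ℝ → ℝ} (uh : Fin (N - 1) → ℝ) (hu : IsSolution α T 0 f u)
    (ht : t ∈ Ioc 0 T) (hf : IsTimeDerivOn t f ft)
    (hR : ∀ s : Finset ℕ, (∀ k ∈ s, 0 < k) →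
      √(∑ k ∈ s, lam k ^ σ * coefBound f ft t k ^ 2) ≤ R) (i : Fin (N - 1)) :
    HasSum (fun k => (sineCoef (u t) k - if k ∈ Finset.Icc 1 (N - 1) then dst N k uh else 0) *
      phi k (node N i)) ((sample N (u t) - uh) i) := by
  obtain ⟨v0, v1, vc⟩ : u t 0 = 0 ∧ u t 1 = 0 ∧ ContinuousOn (u t) (Icc 0 1) := by
    obtain ⟨U, -, -, -, hD⟩ := hu
    obtain ⟨g, hg, -⟩ := hD t ht
    exact ⟨hg.1, hg.2.1, hg.continuousOn⟩
  have hbound : ∀ k : ℕ, ‖sineCoef (u t) k‖ ≤ R * (1 / (k : ℝ) ^ 2) := by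
    intro k
    rcases Nat.eq_zero_or_pos k with rfl | hk
    · simp [sineCoef, phi]
    · have h1 := hR {k} (by simpa using hk)
      rw [Finset.sum_singleton] at h1
      have hFR : coefBound f ft t k ≤ R := by
        refine le_trans (Real.le_sqrt_of_sq_le ?_) h1
        exact le_mul_of_one_le_left (sq_nonneg _) (Real.one_le_rpow (one_le_lam hk) hσ)
      have hk' : (0 : ℝ) < (k : ℝ) ^ 2 := by positivity
      rw [Real.norm_eq_abs, mul_one_div]
      exact (hu.abs_sineCoef_le hα0 hα1 ht hf hk).trans
        (div_le_div₀ ((coefBound_nonneg _ _ _ _).trans hFR) hFR hk' sq_le_lam)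
  have hsum : Summable (sineCoef (u t)) :=
    Summable.of_norm_bounded ((Real.summable_one_div_nat_pow.2 one_lt_two).mul_left R) hbound
  have h1 := hasSum_sineCoef vc v0 v1 hsum (node_mem i)
  have h2 : HasSum (fun k => (if k ∈ Finset.Icc 1 (N - 1) then dst N k uh else 0) *
      phi k (node N i)) (uh i) := by
    rw [← sum_dst_mul_phi uh i]
    have h := hasSum_sum_of_ne_finset_zero (L := SummationFilter.unconditional ℕ)
      (s := Finset.Icc 1 (N - 1)) (f := fun k =>
        (if k ∈ Finset.Icc 1 (N - 1) then dst N k uh else 0) * phi k (node N i))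
      fun k hk => by rw [if_neg hk, zero_mul]
    rwa [Finset.sum_congr rfl fun k hk => by rw [if_pos hk]] at h
  simp only [sub_mul]
  exact h1.sub h2

/-- The error bounds in terms of `R = ‖f(0)‖ + ∫ ‖f_t‖`, for `N ≥ 2`. -/
lemma error_bounds {α T t σ R : ℝ} (hα0 : 0 < α) (hα1 : α < 1) (hσ : 0 ≤ σ) {N : ℕ} (hN : 2 ≤ N)
    {f ft : ℝ → L2} {u : ℝ → ℝ → ℝ} {uh : ℝ → Fin (N - 1) → ℝ} (hu : IsSolution α T 0 f u)
    (huh : IsModifiedSchemeSolution α T N 0 f uh) (ht : t ∈ Ioc 0 T) (hf : IsTimeDerivOn t f ft)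
    (hR : ∀ s : Finset ℕ, (∀ k ∈ s, 0 < k) →
      √(∑ k ∈ s, lam k ^ σ * coefBound f ft t k ^ 2) ≤ R) :
    linfNorm (sample N (u t) - uh t) ≤
      √2 * (1 / (N : ℝ) ^ 2 * √(∑ k ∈ Finset.Icc 1 (N - 1), (k : ℝ) ^ (-(2 * σ))) * R +
        √2 * (1 / (N : ℝ)) ^ (σ + 3 / 2) * R) ∧
    l2Norm (sample N (u t) - uh t) ≤
      √2 * (1 + ∑' j : ℕ, 1 / (j : ℝ) ^ 2) * (1 / (N : ℝ)) ^ 2 * R := by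
  have hR0 : 0 ≤ R := by simpa using hR ∅ (by simp)
  have herr := hu.hasSum_error hα0 hα1 hσ (uh t) ht hf hR
  have h1 : ∀ k ∈ Finset.Icc 1 (N - 1), |sineCoef (u t) k -
      if k ∈ Finset.Icc 1 (N - 1) then dst N k (uh t) else 0| ≤
      coefBound f ft t k / (N : ℝ) ^ 2 := fun k hk => by
    rw [if_pos hk]; exact abs_sineCoef_sub_dst_le hα0 hα1 hu huh ht hf hk
  have h2 : ∀ k, N ≤ k → |sineCoef (u t) k -
      if k ∈ Finset.Icc 1 (N - 1) then dst N k (uh t) else 0| ≤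
      coefBound f ft t k / (k : ℝ) ^ 2 := fun k hk => by
    have hk0 : (0 : ℝ) < k := by exact_mod_cast (by omega : 0 < k)
    rw [if_neg (by rw [Finset.mem_Icc]; omega), sub_zero]
    exact (hu.abs_sineCoef_le hα0 hα1 ht hf (by omega)).trans
      (div_le_div_of_nonneg_left (coefBound_nonneg _ _ _ _) (by positivity) sq_le_lam)
  refine ⟨?_, l2Norm_le_of_hasSum_sineSeries hN hσ hR h1 h2 herr⟩
  exact Real.iSup_le (fun i => abs_le_of_hasSum_sineSeries hN hσ hR h1 h2 (herr i))
    (by positivity)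

lemma rpow_add_three_halves_le {σ : ℝ} {N : ℕ} (hN : 2 ≤ N) :
    (1 / (N : ℝ)) ^ (σ + 3 / 2) ≤ 1 / √(Real.log 2) *
      ((1 / (N : ℝ)) ^ min (σ + 3 / 2) 2 * ell (1 / (N : ℝ)) ^ chi0 (1 / 4 - σ / 2)) := by
  have hN' : (0 : ℝ) < N := by exact_mod_cast (by omega : 0 < N)
  have hl : 0 < √(Real.log 2) := Real.sqrt_pos.2 (Real.log_pos one_lt_two)
  have h1 : (1 / (N : ℝ)) ^ (σ + 3 / 2) ≤ (1 / (N : ℝ)) ^ min (σ + 3 / 2) 2 :=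
    Real.rpow_le_rpow_of_exponent_ge (by positivity)
      (by rw [div_le_one hN']; exact_mod_cast (by omega : 1 ≤ N)) (min_le_left _ _)
  have h2 := le_ell_rpow_chi0 hN (1 / 4 - σ / 2)
  rw [div_mul_eq_mul_div, one_mul, le_div_iff₀ hl]
  exact mul_le_mul h1 h2 hl.le (by positivity)

end

end SubDiffusion

theorem mainTheorem4 (α σ : ℝ) (hα0 : 0 < α) (hα1 : α < 1) (hσ : 0 ≤ σ) :
    ∃ C : ℝ, 0 < C ∧
      ∀ (T : ℝ) (N : ℕ), 0 < T → 1 ≤ N →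
      ∀ (f ft : ℝ → L2) (u : ℝ → ℝ → ℝ) (uhp : ℝ → Fin (N - 1) → ℝ),
        IsSolution α T 0 f u →
        IsModifiedSchemeSolution α T N 0 f uhp →
        ∀ t ∈ Ioc 0 T,
          IsTimeDerivOn t f ft →
          hatNorm σ (f 0) < ∞ →
          ∫⁻ s in Ioc 0 t, hatNorm σ (ft s) < ∞ →
          linfNorm (sample N (u t) - uhp t) ≤
              C * (1 / (N : ℝ)) ^ min (σ + 3 / 2) 2
                * ell (1 / (N : ℝ)) ^ chi0 (1 / 4 - σ / 2)
                * ((hatNorm σ (f 0)).toReal + (∫⁻ s in Ioc 0 t, hatNorm σ (ft s)).toReal) ∧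
          l2Norm (sample N (u t) - uhp t) ≤
              C * (1 / (N : ℝ)) ^ (2 : ℝ)
                * ((hatNorm σ (f 0)).toReal + (∫⁻ s in Ioc 0 t, hatNorm σ (ft s)).toReal) := by
  obtain ⟨C₁, hC₁, hsum⟩ := exists_sqrt_sum_rpow_le hσ
  have hZ0 : 0 ≤ ∑' j : ℕ, 1 / (j : ℝ) ^ 2 := tsum_nonneg fun j => by positivity
  have hl : 0 < √(Real.log 2) := Real.sqrt_pos.2 (Real.log_pos one_lt_two)
  set Cinf : ℝ := √2 * (C₁ + √2 * (1 / √(Real.log 2))) with hCinf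
  set C₂ : ℝ := √2 * (1 + ∑' j : ℕ, 1 / (j : ℝ) ^ 2) with hC₂
  have hCinf0 : 0 < Cinf := by positivity
  have hC₂0 : 0 < C₂ := by positivity
  refine ⟨Cinf + C₂, by positivity, ?_⟩
  intro T N _ hN f ft u uhp hu huh t ht hf h0 h1
  set R := (hatNorm σ (f 0)).toReal + (∫⁻ s in Ioc 0 t, hatNorm σ (ft s)).toReal with hR
  have hR0 : 0 ≤ R := by positivity
  have hell : 0 ≤ ell (1 / (N : ℝ)) := Real.rpow_nonneg (abs_nonneg _) _
  rcases hN.eq_or_lt with rfl | hN2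
  · have hinf : linfNorm (sample 1 (u t) - uhp t) = 0 := by
      have : IsEmpty (Fin (1 - 1)) := Fin.isEmpty
      rw [linfNorm, Real.iSup_of_isEmpty]
    have hl2 : l2Norm (sample 1 (u t) - uhp t) = 0 := by
      simp [l2Norm]
    rw [hinf, hl2]
    exact ⟨by positivity, by positivity⟩
  · obtain ⟨hinf, hl2⟩ := error_bounds hα0 hα1 hσ hN2 hu huh ht hf
      fun s hs => sum_lam_rpow_mul_coefBound_sq_le σ hf h0 h1 hs
    set ρ : ℝ := (1 / (N : ℝ)) ^ min (σ + 3 / 2) 2 *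
      ell (1 / (N : ℝ)) ^ chi0 (1 / 4 - σ / 2) with hρ
    have hρ0 : 0 ≤ ρ := by positivity
    have hA := hsum N hN2
    rw [mul_assoc, ← hρ] at hA
    have hB := rpow_add_three_halves_le (σ := σ) hN2
    rw [← hρ] at hB
    refine ⟨hinf.trans ?_, hl2.trans ?_⟩
    · calc _ ≤ √2 * (C₁ * ρ * R + √2 * (1 / √(Real.log 2) * ρ) * R) := by gcongr
        _ = Cinf * ρ * R := by rw [hCinf]; ring
        _ ≤ (Cinf + C₂) * ρ * R := by gcongr; linarith
        _ = _ := by rw [hρ]; ring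
    · rw [Real.rpow_two]
      gcongr
      linarith
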